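/- Let $n,d\ge 1$, let $M\subset\mathbb{C}^{n+d}$ be a generic real submanifold of class $\mathcal{C}^2$ and of real codimension $d$, and let $p\in M$. Suppose that in suitable local holomorphic coordinates $(z,w)\in\mathbb{C}^n\times\mathbb{C}^d$ centred at $p$, $M$ is given near $p$ by $$\mathrm{Im}\,w_j={}^t\bar z A_j z+h_j(z,\mathrm{Re}\,w),\qquad j=1,\dots,d,$$ where $A_1,\dots,A_d$ are Hermitian matrices of size $n$, and $h=(h_1,\dots,h_d)$ is of class $\mathcal{C}^2$ near $0$ with $h(z,u)=o(|z|^2+|u|)$ as $(z,u)\to 0$. Let $T_pM$ be the tangent space, $N_pM$ its orthogonal complement in $T_p(\mathbb{R}^{2(n+d)})$, $\pi_p$ the orthogonal projection onto $N_pM$ and $J$ the standard complex structure (both $\mathbb{C}$-linearly extended to complexified spaces). Let $T^{(1,0)}_pM=\{Z\in\mathbb{C}\otimes T_pM : JZ=iZ\}$. The Levi map $L_p:T_p^{(1,0)}M\to N_pM$ is $$L_p(X_p)=\frac1{2i}\,\pi_p\bigl(J[\overline X,X](p)\bigr),$$ where $X$ is any local $\mathcal{C}^1$ section of $T^{(1,0)}M$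 near $p$ with $X(p)=X_p$. Then the following conditions are equivalent: (a) $A_1,\dots,A_d$ are linearly independent over $\mathbb{R}$ (equivalently, over $\mathbb{C}$); (1) the image of $L_p$ is not contained in a hyperplane of $N_pM$, that is, in a linear subspace of codimension one; (2) the Levi cone of $M$ at $p$, that is, the convex hull of the image of $L_p$, has nonempty interior in $N_pM$; equivalently, the linear hull of the image of $L_p$ has nonempty interior in $N_pM$; (3) $M$ is of finite type at $p$ with $2$ the only Hörmander number, that is, there are finitely many local $\mathcal{C}^1$ sections $L_1,\dots,L_m$ of $T^{(1,0)}M$ near $p$ such that the values at $p$ of $L_1,\dots,L_m,\overline{L_1},\dots,\overline{L_m}$ and of the Lie brackets of any two of these fields generate the complex vector space $\mathbb{C}\otimes T_pM$. Consequently (a) is a biholomorphic invariant: if $F$ is a biholomorphism from a neighbourhood of $p$ onto an open subset of $\mathbb{C}^{n+d}$, mapping $M$ near $p$ onto $M'$ near $F(p)$, where $M'\subset\mathbb{C}^{n+d}$ is a generic real $\mathcal{C}^2$ submanifold of codimension $d$, and if $M'$ has at $F(p)$ reduced equations as above with Hermitian matrices $A'_1,\dots,A'_d$, then $A_1,\dots,A_d$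 are linearly independent if and only if $A'_1,\dots,A'_d$ are. In particular (a) does not depend on the choice of the reduced equations. -/

import Mathlib

open Filter Topology Asymptotics
open scoped TensorProduct Matrix

noncomputable section

namespace LeviCR

/-- `ℂ^N`, whose underlying real Euclidean space is `ℝ^{2N}`; it is identified with each of its tangent spaces. -/
abbrev CSpace (N : ℕ) : Type := EuclideanSpace ℂ (Fin N)

/-- The complexified tangent space `ℂ ⊗ T_q(ℝ^{2N})`; the complex scalars act on the left factor. -/
abbrev CTangent (N : ℕ) : Type := ℂ ⊗[ℝ] CSpace N

variable {N : ℕ}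

/-- The standard complex structure `J` of `ℝ^{2N} = ℂ^N`, i.e. multiplication by `i`. -/
def J (N : ℕ) : CSpace N →ₗ[ℝ] CSpace N :=
  (LinearMap.lsmul ℂ (CSpace N) Complex.I).restrictScalars ℝ

/-- The tangent space `T_q M`, spanned by the velocities at `q` of curves contained in `M`. -/
def tangentSpace (M : Set (CSpace N)) (q : CSpace N) : Submodule ℝ (CSpace N) :=
  Submodule.span ℝ {v | ∃ γ : ℝ → CSpace N,
    γ 0 = q ∧ (∀ᶠ t in 𝓝 0, γ t ∈ M) ∧ HasDerivAt γ v 0}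

/-- The normal space `N_q M`, the orthogonal complement of `T_q M` in `ℝ^{2N}`. -/
def normalSpace (M : Set (CSpace N)) (q : CSpace N) : Submodule ℝ (CSpace N) :=
  (tangentSpace M q)ᗮ

/-- The orthogonal projection `π_q : ℝ^{2N} → N_q M`. -/
def normalProj (M : Set (CSpace N)) (q : CSpace N) : CSpace N →ₗ[ℝ] normalSpace M q :=
  ((normalSpace M q).orthogonalProjectionOnto : CSpace N →L[ℝ] normalSpace M q).toLinearMap

/-- `M` is a real submanifold of `ℂ^N` of class `C²` and of real codimension `d`. -/
def IsC2Submanifold (d : ℕ) (M : Set (CSpace N)) : Prop :=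
  ∀ q ∈ M, ∃ (U : Set (CSpace N)) (ρ : CSpace N → (Fin d → ℝ)),
    IsOpen U ∧ q ∈ U ∧ ContDiffOn ℝ 2 ρ U ∧ M ∩ U = {x ∈ U | ρ x = 0} ∧
      Function.Surjective (fderiv ℝ ρ q)

/-- `M` is generic: `T_q M + J T_q M = T_q ℂ^N` at every point `q` of `M`. -/
def IsGeneric (M : Set (CSpace N)) : Prop :=
  ∀ q ∈ M, tangentSpace M q ⊔ (tangentSpace M q).map (J N) = ⊤

/-- The space `T_q^{(1,0)} M`: the vectors `Z` of `ℂ ⊗ T_q M` with `J Z = i Z`. -/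
def holTangent (M : Set (CSpace N)) (q : CSpace N) : Submodule ℂ (CTangent N) :=
  (tangentSpace M q).baseChange ℂ ⊓
    LinearMap.ker ((J N).baseChange ℂ - Complex.I • LinearMap.id)

/-- A complex vector field `re + i im` on `ℂ^N`, where `re` and `im` are real vector fields. -/
structure CField (N : ℕ) where
  re : CSpace N → CSpace N
  im : CSpace N → CSpace N

namespace CField

/-- The value at `q`, in the complexified tangent space. -/
def eval (X : CField N) (q : CSpace N) : CTangent N :=
  (1 : ℂ) ⊗ₜ[ℝ] X.re q + Complex.I ⊗ₜ[ℝ] X.im q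

/-- The conjugate field. -/
def conj (X : CField N) : CField N where
  re := X.re
  im := fun q => -X.im q

/-- The Lie bracket, extended to complex fields by complex bilinearity. -/
def bracket (X Y : CField N) : CField N where
  re := fun q => VectorField.lieBracket ℝ X.re Y.re q - VectorField.lieBracket ℝ X.im Y.im q
  im := fun q => VectorField.lieBracket ℝ X.re Y.im q + VectorField.lieBracket ℝ X.im Y.re q

end CField

/-- `X` is a `C¹` section of `T^{(1,0)} M` near `p`, extended to a `C¹` field on a neighbourhood of `p` in `ℂ^N`.
Brackets at `p` of such fields and of their conjugates only depend on the restrictions to `M`,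
the fields being tangent to `M`. -/
def IsHolField (M : Set (CSpace N)) (p : CSpace N) (X : CField N) : Prop :=
  ContDiffAt ℝ 1 X.re p ∧ ContDiffAt ℝ 1 X.im p ∧ ∀ᶠ q in 𝓝[M] p, X.eval q ∈ holTangent M q

/-- `η = (1/2i) π_p (J [X̄, X](p))` for some local section `X` of `T^{(1,0)} M` with `X(p) = Z`. -/
def IsLeviValue (M : Set (CSpace N)) (p : CSpace N) (Z : CTangent N) (η : normalSpace M p) : Prop :=
  ∃ X : CField N, IsHolField M p X ∧ X.eval p = Z ∧
    (1 : ℂ) ⊗ₜ[ℝ] η = (1 / (2 * Complex.I)) •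
      (normalProj M p).baseChange ℂ ((J N).baseChange ℂ ((X.conj.bracket X).eval p))

open Classical in
/-- The Levi map `L_p : T_p^{(1,0)} M → N_p M`. For a `C²` CR submanifold the vector `(1/2i) π_p (J [X̄, X](p))` is
real and depends only on `X(p)`, so that there is exactly one value to choose. -/
def leviMap (M : Set (CSpace N)) (p : CSpace N) (Z : holTangent M p) : normalSpace M p :=
  if h : ∃ η, IsLeviValue M p (Z : CTangent N) η then h.choose else 0

/-- `M` is of finite type at `p` with `2` the only Hörmander number: for some sections `L_1, …, L_m` of `T^{(1,0)} M`
near `p`, the values at `p` of the `L_i`, of the conjugates `L̄_i` and of the Lie brackets of any two of these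
fields generate `ℂ ⊗ T_p M`. -/
def IsFiniteTypeTwo (M : Set (CSpace N)) (p : CSpace N) : Prop :=
  ∃ (m : ℕ) (L : Fin m → CField N), (∀ i, IsHolField M p (L i)) ∧
    ∃ S : Set (CField N), S = Set.range L ∪ Set.range (fun i => (L i).conj) ∧
      Submodule.span ℂ ({Z | ∃ X ∈ S, Z = X.eval p} ∪
          {Z | ∃ X ∈ S, ∃ Y ∈ S, Z = (X.bracket Y).eval p}) =
        (tangentSpace M p).baseChange ℂ

/-- `Φ` is a biholomorphism between its (open) source and target. -/
def IsBiholomorphism {E F : Type*} [NormedAddCommGroup E] [NormedSpace ℂ E]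
    [NormedAddCommGroup F] [NormedSpace ℂ F] (Φ : OpenPartialHomeomorph E F) : Prop :=
  DifferentiableOn ℂ Φ Φ.source ∧ DifferentiableOn ℂ Φ.symm Φ.target

/-- In suitable local holomorphic coordinates `(z, w) ∈ ℂ^n × ℂ^d` centred at `p`, `M` has the reduced equations
`Im w_j = ᵗz̄ A_j z + h_j(z, Re w)`, `A_j` Hermitian, `h` of class `C²`, `h = o(|z|² + |Re w|)`. -/
def HasReducedEquation {n d : ℕ} (M : Set (CSpace N)) (p : CSpace N)
    (A : Fin d → Matrix (Fin n) (Fin n) ℂ) : Prop :=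
  (∀ j, (A j).IsHermitian) ∧
  ∃ (Φ : OpenPartialHomeomorph (CSpace N) ((Fin n → ℂ) × (Fin d → ℂ)))
    (h : (Fin n → ℂ) × (Fin d → ℝ) → (Fin d → ℝ)),
    IsBiholomorphism Φ ∧ p ∈ Φ.source ∧ Φ p = 0 ∧
    ContDiffAt ℝ 2 h 0 ∧
    h =o[𝓝 0] (fun x : (Fin n → ℂ) × (Fin d → ℝ) => ‖x.1‖ ^ 2 + ‖x.2‖) ∧
    ∀ᶠ q in 𝓝 p, (q ∈ M ↔ ∀ j : Fin d,
      (((Φ q).2 j).im : ℂ) =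
        star (Φ q).1 ⬝ᵥ (A j *ᵥ (Φ q).1) + (h ((Φ q).1, fun k => ((Φ q).2 k).re) j : ℂ))

end LeviCR

end

/-!
Let `M = {ρ = 0}` near `p`, where `(dρ, dρ ∘ J)` is onto by genericity, and let
`ℓ(v, w) = D²ρ(v, w) + D²ρ(Jv, Jw)` be the Levi form of `ρ`. Differentiating `dρ(W) = dρ(JW) = 0`
along `M` gives `dρ(J[V, W]) = -ℓ(V, JW)` for real fields `V`, `W` in the complex tangent bundle.
A section of `T^{(1,0)} M` is `X = V - iJV`, and `[X̄, X] = -2i[V, JV]`; hence the isomorphism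
`N_p M ≅ ℝ^d` induced by `dρ` carries the Levi map to `v ↦ -ℓ(v, v)`, and each of the conditions
(1), (2), (3) says that the values of this quadratic map span `ℝ^d`.

On the complex tangent space `ℓ` is pulled back by holomorphic maps, so it may be computed in the
coordinates of the reduced equations, where `ℓ(v, v)` is `-4 ᵗz̄ A_j z`. These values span `ℝ^d`
exactly when no nontrivial real combination of the Hermitian matrices `A_j` vanishes.
-/

noncomputable section

namespace LeviCR

section Osgood

open Metric

variable {E F : Type*} [NormedAddCommGroup E] [NormedSpace ℂ E] [NormedAddCommGroup F]
  [NormedSpace ℂ F]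

theorem norm_sub_sub_fderiv_le_of_forall_mem_ball {f : E → F} {x y : E} {R C : ℝ}
    (hf : DifferentiableOn ℂ f (ball x R)) (hC : ∀ z ∈ ball x R, ‖f z‖ ≤ C) (hy : y ∈ ball x R) :
    ‖f y - f x - fderiv ℂ f x (y - x)‖ ≤ 4 * C * (‖y - x‖ / R) ^ 2 := by
  have hR : 0 < R := pos_of_mem_ball hy
  have hmaps : Set.MapsTo f (ball x R) (closedBall (f x) (2 * C)) := fun z hz => by
    rw [mem_closedBall, dist_eq_norm, two_mul]
    exact (norm_sub_le _ _).trans (add_le_add (hC z hz) (hC x (mem_ball_self hR)))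
  have hD : ‖fderiv ℂ f x‖ ≤ 2 * C / R := Complex.norm_fderiv_le_div_of_mapsTo_ball hf hmaps hR
  have hfx : HasFDerivAt f (fderiv ℂ f x) x :=
    (hf.differentiableAt (ball_mem_nhds x hR)).hasFDerivAt
  let g : E → F := fun z => f z - f x - fderiv ℂ f x (z - x)
  have hgx : g x = 0 := by simp [g]
  have hg : Set.MapsTo g (ball x R) (closedBall (g x) (4 * C)) := fun z hz => by
    rw [hgx, mem_closedBall_zero_iff]
    calc ‖g z‖ ≤ ‖f z - f x‖ + ‖fderiv ℂ f x‖ * ‖z - x‖ :=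
          (norm_sub_le _ _).trans (by gcongr; exact ContinuousLinearMap.le_opNorm _ _)
      _ ≤ 2 * C + 2 * C / R * R := by
          gcongr
          · exact mem_closedBall_iff_norm.1 (hmaps hz)
          · exact (norm_nonneg _).trans hD
          · exact (mem_ball_iff_norm.1 hz).le
      _ = 4 * C := by field_simp; ring
  have hgo : (g · - g x) =o[𝓝 x] fun z => (‖z - x‖ ^ 1 : ℝ) := by
    simpa only [g, hgx, sub_zero, pow_one] using hfx.isLittleO.norm_right
  simpa [g, dist_eq_norm] using Complex.dist_le_mul_div_pow_of_mapsTo_ball_of_isLittleO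
    ((hf.sub_const _).sub (by fun_prop)) hg hgo hy

theorem uniformCauchySeqOn_fderiv {ι : Type*} {l : Filter ι} {f : ι → E → F} {x : E} {r δ : ℝ}
    (hδ : 0 < δ) (hf : ∀ᶠ i in l, DifferentiableOn ℂ (f i) (ball x (r + δ)))
    (hfl : UniformCauchySeqOn f l (ball x (r + δ))) :
    UniformCauchySeqOn (fun i => fderiv ℂ (f i)) l (ball x r) := by
  intro u hu
  obtain ⟨ε, hε, hεu⟩ := mem_uniformity_dist.1 hu
  have hc := hfl _ (dist_mem_uniformity (by positivity : 0 < ε * δ / 4))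
  filter_upwards [hc, hf.prod_mk hf] with ⟨i, j⟩ hij ⟨hi, hj⟩ y hy
  have hball : ball y δ ⊆ ball x (r + δ) := ball_subset (by
    rw [mem_ball] at hy; linarith)
  have hd := (hi.mono hball).sub (hj.mono hball)
  have hmaps : Set.MapsTo (f i - f j) (ball y δ) (closedBall ((f i - f j) y) (ε * δ / 2)) := by
    intro z hz
    have hz' := hij z (hball hz)
    have hy' := hij y (hball (mem_ball_self hδ))
    rw [dist_eq_norm] at hz' hy'
    rw [mem_closedBall, dist_eq_norm]
    exact (norm_sub_le _ _).trans (by simp only [Pi.sub_apply]; linarith)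
  have hle := Complex.norm_fderiv_le_div_of_mapsTo_ball hd hmaps hδ
  rw [fderiv_sub (hi.differentiableAt (isOpen_ball.mem_nhds (hball (mem_ball_self hδ))))
    (hj.differentiableAt (isOpen_ball.mem_nhds (hball (mem_ball_self hδ)))), ← dist_eq_norm] at hle
  refine hεu (hle.trans_lt ?_)
  rw [div_lt_iff₀ hδ]
  nlinarith [mul_pos hε hδ]

theorem differentiableAt_of_tendstoUniformlyOn_ball [CompleteSpace F] {ι : Type*} {l : Filter ι}
    [NeBot l] {f : ι → E → F} {g : E → F} {x : E} {R : ℝ} (hR : 0 < R)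
    (hf : ∀ᶠ i in l, DifferentiableOn ℂ (f i) (ball x R))
    (hfg : TendstoUniformlyOn f g l (ball x R)) : DifferentiableAt ℂ g x := by
  have hC : UniformCauchySeqOn (fun i => fderiv ℂ (f i)) l (ball x (R / 2)) :=
    uniformCauchySeqOn_fderiv (half_pos hR) (by rwa [add_halves])
      (by rw [add_halves]; exact hfg.uniformCauchySeqOn)
  have hlim : ∀ y ∈ ball x (R / 2), ∃ D, Tendsto (fun i => fderiv ℂ (f i) y) l (𝓝 D) :=
    fun y hy => cauchy_map_iff_exists_tendsto.1 (hC.cauchy_map hy)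
  choose! D hD using hlim
  have hx : ball x (R / 2) ∈ 𝓝 x := ball_mem_nhds x (half_pos hR)
  refine (hasFDerivAt_of_tendstoUniformlyOnFilter (l := l) (f := f)
    (f' := fun i => fderiv ℂ (f i)) (g' := D) ?_ ?_ ?_).differentiableAt
  · exact ((hC.tendstoUniformlyOn_of_tendsto hD).tendstoUniformlyOnFilter).mono_right
      (le_principal_iff.2 hx)
  · filter_upwards [hf.prod_mk (ball_mem_nhds x hR)] with ⟨i, y⟩ ⟨hi, hy⟩
    exact (hi.differentiableAt (isOpen_ball.mem_nhds hy)).hasFDerivAt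
  · filter_upwards [ball_mem_nhds x hR] with y hy using hfg.tendsto_at hy

theorem tendstoUniformlyOn_inv_smul_sub {f : E → F} {x : E} {r C : ℝ} (hr : 0 < r)
    (hf : DifferentiableOn ℂ f (ball x (r + r))) (hC : ∀ z ∈ ball x (r + r), ‖f z‖ ≤ C) (v : E) :
    TendstoUniformlyOn (fun (ζ : ℂ) y => ζ⁻¹ • (f (y + ζ • v) - f y)) (fun y => fderiv ℂ f y v)
      (𝓝[≠] 0) (ball x r) := by
  rw [Metric.tendstoUniformlyOn_iff]
  intro ε hε
  have hv : ∀ᶠ ζ : ℂ in 𝓝[≠] 0, ‖ζ • v‖ < r :=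
    nhdsWithin_le_nhds <| ContinuousAt.eventually_lt (by fun_prop) (by fun_prop) (by simpa)
  have hCζ : ∀ᶠ ζ : ℂ in 𝓝[≠] 0, 4 * C * (‖v‖ / r) ^ 2 * ‖ζ‖ < ε :=
    nhdsWithin_le_nhds <| ContinuousAt.eventually_lt (by fun_prop) (by fun_prop) (by simpa)
  filter_upwards [hv, hCζ, self_mem_nhdsWithin] with ζ hζv hζC hζ y hy
  have hball : ball y r ⊆ ball x (r + r) := ball_subset (by rw [mem_ball] at hy; linarith)
  have hT := norm_sub_sub_fderiv_le_of_forall_mem_ball (hf.mono hball)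
    (fun z hz => hC z (hball hz)) (y := y + ζ • v) (by simpa [mem_ball_iff_norm] using hζv)
  have hζ0 : 0 < ‖ζ‖ := norm_pos_iff.2 hζ
  have heq : ζ⁻¹ • (f (y + ζ • v) - f y) - fderiv ℂ f y v =
      ζ⁻¹ • (f (y + ζ • v) - f y - fderiv ℂ f y (y + ζ • v - y)) := by
    rw [add_sub_cancel_left, map_smul, smul_sub _ _ (ζ • _), inv_smul_smul₀ hζ]
  rw [dist_comm, dist_eq_norm, heq, norm_smul, norm_inv, inv_mul_lt_iff₀ hζ0]
  refine hT.trans_lt ?_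
  rw [add_sub_cancel_left, norm_smul]
  calc 4 * C * (‖ζ‖ * ‖v‖ / r) ^ 2 = ‖ζ‖ * (4 * C * (‖v‖ / r) ^ 2 * ‖ζ‖) := by ring
    _ < ‖ζ‖ * ε := by gcongr

theorem differentiableOn_fderiv_apply [CompleteSpace F] {f : E → F} {U : Set E} (hU : IsOpen U)
    (hf : DifferentiableOn ℂ f U) (v : E) : DifferentiableOn ℂ (fun x => fderiv ℂ f x v) U := by
  intro x hx
  have hbdd : ∀ᶠ y in 𝓝 x, y ∈ U ∧ ‖f y‖ < ‖f x‖ + 1 :=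
    (hU.eventually_mem hx).and <|
      (hf.continuousOn.continuousAt (hU.mem_nhds hx)).norm.eventually_lt_const (lt_add_one _)
  obtain ⟨R, hR, hRball⟩ := Metric.eventually_nhds_iff_ball.1 hbdd
  have hfR : DifferentiableOn ℂ f (ball x (R / 2 + R / 2)) :=
    hf.mono fun y hy => (hRball y (by rwa [add_halves] at hy)).1
  have hlim := tendstoUniformlyOn_inv_smul_sub (C := ‖f x‖ + 1) (half_pos hR) hfR
    (fun y hy => (hRball y (by rwa [add_halves] at hy)).2.le) v
  refine (differentiableAt_of_tendstoUniformlyOn_ball (half_pos hR) ?_ hlim)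
    |>.differentiableWithinAt
  have hv : ∀ᶠ ζ : ℂ in 𝓝[≠] 0, ‖ζ • v‖ < R / 2 :=
    nhdsWithin_le_nhds <| ContinuousAt.eventually_lt (by fun_prop) (by fun_prop) (by simpa)
  filter_upwards [hv] with ζ hζ
  have hshift : Set.MapsTo (fun y => y + ζ • v) (ball x (R / 2)) (ball x (R / 2 + R / 2)) :=
    fun y hy => by
      rw [mem_ball_iff_norm] at hy ⊢
      rw [add_sub_right_comm]
      exact (norm_add_le _ _).trans_lt (add_lt_add hy hζ)
  exact ((hfR.comp (by fun_prop) hshift).sub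
    (hfR.mono (ball_subset_ball (by linarith)))).const_smul _

theorem contDiffOn_of_differentiableOn_complex [FiniteDimensional ℂ E] [CompleteSpace F] {U : Set E}
    (hU : IsOpen U) (n : ℕ) {f : E → F} (hf : DifferentiableOn ℂ f U) : ContDiffOn ℂ n f U := by
  induction n generalizing f with
  | zero => exact contDiffOn_zero.2 hf.continuousOn
  | succ n ih =>
    rw [Nat.cast_succ, contDiffOn_succ_iff_fderiv_of_isOpen hU]
    exact ⟨hf, fun h => absurd h (by simp), contDiffOn_clm_apply.2 fun v =>
      ih (differentiableOn_fderiv_apply hU hf v)⟩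

end Osgood

section SecondDerivative

variable {𝕜 : Type*} [NontriviallyNormedField 𝕜] {E F G : Type*} [NormedAddCommGroup E]
  [NormedSpace 𝕜 E] [NormedAddCommGroup F] [NormedSpace 𝕜 F] [NormedAddCommGroup G]
  [NormedSpace 𝕜 G]

theorem differentiableAt_fderiv_of_contDiffAt {f : E → F} {x : E} (hf : ContDiffAt 𝕜 2 f x) :
    DifferentiableAt 𝕜 (fderiv 𝕜 f) x :=
  (hf.fderiv_right (m := 1) (by norm_num)).differentiableAt one_ne_zero

theorem fderiv_fderiv_comm [IsRCLikeNormedField 𝕜] {f : E → F} {x : E} (hf : ContDiffAt 𝕜 2 f x)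
    (v w : E) : fderiv 𝕜 (fderiv 𝕜 f) x v w = fderiv 𝕜 (fderiv 𝕜 f) x w v :=
  (hf.isSymmSndFDerivAt (by simp)).eq v w

theorem fderiv_fderiv_comp_apply {g : F → G} {f : E → F} {x : E} (hg : ContDiffAt 𝕜 2 g (f x))
    (hf : ContDiffAt 𝕜 2 f x) (v w : E) :
    fderiv 𝕜 (fderiv 𝕜 (g ∘ f)) x v w =
      fderiv 𝕜 (fderiv 𝕜 g) (f x) (fderiv 𝕜 f x v) (fderiv 𝕜 f x w) +
        fderiv 𝕜 g (f x) (fderiv 𝕜 (fderiv 𝕜 f) x v w) := by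
  have hfx : DifferentiableAt 𝕜 f x := hf.differentiableAt two_ne_zero
  have hgf : DifferentiableAt 𝕜 (fderiv 𝕜 g ∘ f) x :=
    (differentiableAt_fderiv_of_contDiffAt hg).comp x hfx
  have hchain : fderiv 𝕜 (g ∘ f) =ᶠ[𝓝 x] fun y => (fderiv 𝕜 g ∘ f) y ∘L fderiv 𝕜 f y := by
    filter_upwards [hf.eventually (by simp),
      hf.continuousAt.eventually (hg.eventually (by simp))] with y hfy hgy
    exact fderiv_comp y (hgy.differentiableAt two_ne_zero) (hfy.differentiableAt two_ne_zero)
  rw [hchain.fderiv_eq, fderiv_clm_comp hgf (differentiableAt_fderiv_of_contDiffAt hf),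
    fderiv_comp x (differentiableAt_fderiv_of_contDiffAt hg) hfx]
  simp [add_comm]

variable {𝕜' : Type*} [NontriviallyNormedField 𝕜'] [NormedAlgebra 𝕜 𝕜'] [NormedSpace 𝕜' E]
  [IsScalarTower 𝕜 𝕜' E] [NormedSpace 𝕜' F] [IsScalarTower 𝕜 𝕜' F]

variable (𝕜) in
theorem fderiv_fderiv_restrictScalars_apply {f : E → F} {x : E} (hf : ContDiffAt 𝕜' 2 f x)
    (v w : E) : fderiv 𝕜 (fderiv 𝕜 f) x v w = fderiv 𝕜' (fderiv 𝕜' f) x v w := by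
  have hres : fderiv 𝕜 f =ᶠ[𝓝 x] fun y => (fderiv 𝕜' f y).restrictScalars 𝕜 := by
    filter_upwards [hf.eventually (by simp)] with y hy
    exact (hy.differentiableAt two_ne_zero).fderiv_restrictScalars 𝕜
  have hD : HasFDerivAt (fun y => (fderiv 𝕜' f y).restrictScalars 𝕜)
      ((ContinuousLinearMap.restrictScalarsL 𝕜' E F 𝕜 𝕜) ∘L
        (fderiv 𝕜' (fderiv 𝕜' f) x).restrictScalars 𝕜) x :=
    (ContinuousLinearMap.restrictScalarsL 𝕜' E F 𝕜 𝕜).hasFDerivAt.comp x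
      ((differentiableAt_fderiv_of_contDiffAt hf).hasFDerivAt.restrictScalars 𝕜)
  rw [hres.fderiv_eq, hD.fderiv]
  rfl

end SecondDerivative

section Taylor

variable {E F : Type*} [NormedAddCommGroup E] [NormedSpace ℝ E] [NormedAddCommGroup F]
  [NormedSpace ℝ F]

theorem isLittleO_taylor_two {f : E → F} {x : E} (hf : ContDiffAt ℝ 2 f x) :
    (fun y => f y - f x - fderiv ℝ f x (y - x) -
      (1 / 2 : ℝ) • fderiv ℝ (fderiv ℝ f) x (y - x) (y - x)) =o[𝓝 x] fun y => ‖y - x‖ ^ 2 := by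
  set B := fderiv ℝ (fderiv ℝ f) x with hB
  obtain ⟨ε, hε, hdiff⟩ := Metric.eventually_nhds_iff_ball.1 (hf.eventually (by simp))
  have hball : 𝓝[Metric.ball x ε] x = 𝓝 x := nhdsWithin_eq_nhds.2 (Metric.ball_mem_nhds x hε)
  have hquad (y : E) : HasFDerivAt (fun y => (1 / 2 : ℝ) • B (y - x) (y - x)) (B (y - x)) y := by
    have hsub : HasFDerivAt (fun y => y - x) (.id ℝ E) y := (hasFDerivAt_id y).sub_const x
    refine (((B.hasFDerivAt.comp y hsub).clm_apply hsub).const_smul (1 / 2 : ℝ)).congr_fderiv ?_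
    ext v
    simp [hB, fderiv_fderiv_comm hf v, ← two_smul ℝ, smul_smul]
  have hderiv (y : E) (hy : y ∈ Metric.ball x ε) :
      HasFDerivWithinAt (fun y => f y - fderiv ℝ f x (y - x) - (1 / 2 : ℝ) • B (y - x) (y - x))
        (fderiv ℝ f y - fderiv ℝ f x - B (y - x)) (Metric.ball x ε) y :=
    ((((hdiff y hy).differentiableAt two_ne_zero).hasFDerivAt.sub
      ((fderiv ℝ f x).hasFDerivAt.comp y ((hasFDerivAt_id y).sub_const x))).sub
        (hquad y)).hasFDerivWithinAt
  have hrem : (fun y => fderiv ℝ f y - fderiv ℝ f x - B (y - x)) =o[𝓝 x] fun y => ‖y - x‖ ^ 1 := by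
    simpa using (differentiableAt_fderiv_of_contDiffAt hf).hasFDerivAt.isLittleO.norm_right
  have htaylor := (convex_ball x ε).isLittleO_pow_succ (Metric.mem_ball_self hε) hderiv
    (hball.symm ▸ hrem)
  rw [hball] at htaylor
  refine htaylor.congr_left fun y => ?_
  simp only [sub_self, map_zero, smul_zero, sub_zero]
  abel

theorem eq_zero_of_sq_smul_isLittleO {a : F}
    (ha : (fun t : ℝ => t ^ 2 • a) =o[𝓝 0] fun t : ℝ => t ^ 2) : a = 0 := by
  have hlim : Tendsto (fun _ : ℝ => a) (𝓝[≠] 0) (𝓝 0) := by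
    refine (ha.tendsto_inv_smul_nhds_zero.mono_left nhdsWithin_le_nhds).congr' ?_
    filter_upwards [self_mem_nhdsWithin] with t ht
    exact inv_smul_smul₀ (pow_ne_zero 2 ht) a
  exact tendsto_nhds_unique tendsto_const_nhds hlim

theorem fderiv_fderiv_apply_self_of_isLittleO {f : E → F} {x v : E} {a : F}
    (hf : ContDiffAt ℝ 2 f x)
    (ha : (fun t : ℝ => f (x + t • v) - f x - t • fderiv ℝ f x v - t ^ 2 • a)
      =o[𝓝 0] fun t : ℝ => t ^ 2) :
    fderiv ℝ (fderiv ℝ f) x v v = (2 : ℝ) • a := by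
  have hline : Tendsto (fun t : ℝ => x + t • v) (𝓝 0) (𝓝 x) := by
    have : Continuous fun t : ℝ => x + t • v := by fun_prop
    simpa using this.tendsto 0
  have htaylor := ((isLittleO_taylor_two hf).comp_tendsto hline).trans_isBigO
    (k := fun t : ℝ => t ^ 2) (IsBigO.of_bound (‖v‖ ^ 2) (Eventually.of_forall fun t => by
      simp [norm_smul, mul_pow, mul_comm]))
  have hdiff : (1 / 2 : ℝ) • fderiv ℝ (fderiv ℝ f) x v v - a = 0 := by
    refine eq_zero_of_sq_smul_isLittleO ((ha.sub htaylor).congr_left fun t => ?_)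
    simp only [Function.comp_apply, add_sub_cancel_left, map_smul, smul_apply]
    module
  rw [← sub_eq_zero.1 hdiff, smul_smul]
  norm_num

theorem fderiv_zero_eq_zero_of_even {𝕜 : Type*} [NontriviallyNormedField 𝕜] [CharZero 𝕜]
    {E F : Type*} [NormedAddCommGroup E] [NormedSpace 𝕜 E] [NormedAddCommGroup F]
    [NormedSpace 𝕜 F] {f : E → F} (hf : f.Even) : fderiv 𝕜 f 0 = 0 := by
  have hneg : fderiv 𝕜 f 0 = -fderiv 𝕜 f 0 := by
    conv_lhs => rw [← funext hf]
    simpa using fderiv_comp_smul (𝕜 := 𝕜) (f := f) (x := 0) (-1)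
  rw [eq_neg_iff_add_eq_zero, ← two_smul 𝕜] at hneg
  exact (smul_eq_zero.1 hneg).resolve_left two_ne_zero

end Taylor

section LeviForm

theorem I_smul_I_smul {E : Type*} [AddCommGroup E] [Module ℂ E] (v : E) :
    Complex.I • Complex.I • v = -v := by
  rw [smul_smul, Complex.I_mul_I, neg_one_smul]

variable {E G F : Type*} [NormedAddCommGroup E] [NormedSpace ℝ E] [NormedSpace ℂ E]
  [IsScalarTower ℝ ℂ E] [NormedAddCommGroup G] [NormedSpace ℝ G] [NormedSpace ℂ G]
  [IsScalarTower ℝ ℂ G] [NormedAddCommGroup F] [NormedSpace ℝ F]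

/-- The pair of real linear maps `(dρ, dρ ∘ J)` at `x`, where `J` is the multiplication by `i`. -/
def derivPair (ρ : E → F) (x : E) : E →L[ℝ] F × F :=
  (fderiv ℝ ρ x).prod (fderiv ℝ ρ x ∘L (Complex.I • ContinuousLinearMap.id ℝ E))

/-- The largest complex subspace of the kernel of the derivative of `ρ` at `x`, i.e. the complex
tangent space at `x` of the level set of `ρ` through `x`. -/
def complexKer (ρ : E → F) (x : E) : Submodule ℝ E := LinearMap.ker (derivPair ρ x).toLinearMap

/-- The Levi form of `ρ` at `x`: the symmetrization under multiplication by `i` of the second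
derivative, so that `leviForm ρ x v v` is four times the complex Hessian
`∑ ∂²ρ/∂z_j∂z̄_k v_j v̄_k`. -/
def leviForm (ρ : E → F) (x : E) : E →ₗ[ℝ] E →ₗ[ℝ] F :=
  LinearMap.mk₂ ℝ (fun v w => fderiv ℝ (fderiv ℝ ρ) x v w +
      fderiv ℝ (fderiv ℝ ρ) x (Complex.I • v) (Complex.I • w))
    (fun v v' w => by simp only [smul_add, map_add, add_apply]; abel)
    (fun c v w => by simp only [smul_comm Complex.I c, map_smul, smul_apply, smul_add])
    (fun v w w' => by simp only [smul_add, map_add]; abel)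
    (fun c v w => by simp only [smul_comm Complex.I c, map_smul, smul_add])

/-- The real span of the values `ℓ(v, v)` of the Levi form `ℓ` of `ρ` on the complex tangent
space. -/
def leviSpan (ρ : E → F) (x : E) : Submodule ℝ F :=
  Submodule.span ℝ ((fun v => leviForm ρ x v v) '' complexKer ρ x)

variable {ρ : E → F} {x v w : E}

theorem derivPair_apply (ρ : E → F) (x v : E) :
    derivPair ρ x v = (fderiv ℝ ρ x v, fderiv ℝ ρ x (Complex.I • v)) := rfl

theorem mem_complexKer :
    v ∈ complexKer ρ x ↔ fderiv ℝ ρ x v = 0 ∧ fderiv ℝ ρ x (Complex.I • v) = 0 :=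
  Prod.mk_eq_zero

theorem I_smul_mem_complexKer (hv : v ∈ complexKer ρ x) : Complex.I • v ∈ complexKer ρ x := by
  rw [mem_complexKer] at hv ⊢
  exact ⟨hv.2, by rw [I_smul_I_smul, map_neg, hv.1, neg_zero]⟩

theorem leviForm_apply (ρ : E → F) (x v w : E) :
    leviForm ρ x v w = fderiv ℝ (fderiv ℝ ρ) x v w +
      fderiv ℝ (fderiv ℝ ρ) x (Complex.I • v) (Complex.I • w) := rfl

theorem leviForm_I_smul_right (ρ : E → F) (x v w : E) : leviForm ρ x v (Complex.I • w) =
    fderiv ℝ (fderiv ℝ ρ) x v (Complex.I • w) - fderiv ℝ (fderiv ℝ ρ) x (Complex.I • v) w := by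
  rw [leviForm_apply, I_smul_I_smul, map_neg, sub_eq_add_neg]

theorem leviForm_comm (hρ : ContDiffAt ℝ 2 ρ x) (v w : E) :
    leviForm ρ x v w = leviForm ρ x w v := by
  rw [leviForm_apply, leviForm_apply, fderiv_fderiv_comm hρ v w,
    fderiv_fderiv_comm hρ (Complex.I • v)]

theorem leviForm_self_mem_leviSpan (hv : v ∈ complexKer ρ x) : leviForm ρ x v v ∈ leviSpan ρ x :=
  Submodule.subset_span ⟨v, hv, rfl⟩

theorem leviForm_mem_leviSpan (hρ : ContDiffAt ℝ 2 ρ x) (hv : v ∈ complexKer ρ x)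
    (hw : w ∈ complexKer ρ x) : leviForm ρ x v w ∈ leviSpan ρ x := by
  have hpolar : leviForm ρ x v w = (1 / 2 : ℝ) •
      (leviForm ρ x (v + w) (v + w) - leviForm ρ x v v - leviForm ρ x w w) := by
    simp only [map_add, LinearMap.add_apply, leviForm_comm hρ w v]
    module
  rw [hpolar]
  exact Submodule.smul_mem _ _ <| sub_mem
    (sub_mem (leviForm_self_mem_leviSpan (add_mem hv hw)) (leviForm_self_mem_leviSpan hv))
    (leviForm_self_mem_leviSpan hw)

theorem leviForm_eq_zero_of_contDiffAt_complex {Φ : E → G} (hΦ : ContDiffAt ℂ 2 Φ x) (v w : E) :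
    leviForm Φ x v w = 0 := by
  rw [leviForm_apply, fderiv_fderiv_restrictScalars_apply ℝ hΦ,
    fderiv_fderiv_restrictScalars_apply ℝ hΦ]
  simp [smul_smul]

variable {Φ : E → G} {r : G → F}

theorem derivPair_comp (hr : DifferentiableAt ℝ r (Φ x)) (hΦ : DifferentiableAt ℂ Φ x) (v : E) :
    derivPair (r ∘ Φ) x v = derivPair r (Φ x) (fderiv ℂ Φ x v) := by
  have hΦr : fderiv ℝ Φ x = (fderiv ℂ Φ x).restrictScalars ℝ := hΦ.fderiv_restrictScalars ℝ
  rw [derivPair_apply, derivPair_apply, fderiv_comp x hr (hΦ.restrictScalars ℝ), hΦr, ← map_smul]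
  rfl

theorem leviForm_comp (hr : ContDiffAt ℝ 2 r (Φ x)) (hΦ : ContDiffAt ℂ 2 Φ x) (v w : E) :
    leviForm (r ∘ Φ) x v w = leviForm r (Φ x) (fderiv ℂ Φ x v) (fderiv ℂ Φ x w) := by
  have hΦr : fderiv ℝ Φ x = (fderiv ℂ Φ x).restrictScalars ℝ :=
    (hΦ.differentiableAt two_ne_zero).fderiv_restrictScalars ℝ
  have hzero : fderiv ℝ r (Φ x) (leviForm Φ x v w) = 0 := by
    rw [leviForm_eq_zero_of_contDiffAt_complex hΦ, map_zero]
  rw [leviForm_apply, map_add] at hzero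
  have hΦℝ : ContDiffAt ℝ 2 Φ x := hΦ.restrict_scalars ℝ
  rw [leviForm_apply, fderiv_fderiv_comp_apply hr hΦℝ, fderiv_fderiv_comp_apply hr hΦℝ,
    add_add_add_comm, hzero, add_zero, hΦr, leviForm_apply, ← map_smul, ← map_smul]
  rfl

theorem leviSpan_comp (hr : ContDiffAt ℝ 2 r (Φ x)) (hΦ : ContDiffAt ℂ 2 Φ x)
    (hsurj : Function.Surjective (fderiv ℂ Φ x)) : leviSpan (r ∘ Φ) x = leviSpan r (Φ x) := by
  have hker (v : E) : v ∈ complexKer (r ∘ Φ) x ↔ fderiv ℂ Φ x v ∈ complexKer r (Φ x) := by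
    rw [complexKer, LinearMap.mem_ker, ContinuousLinearMap.coe_coe,
      derivPair_comp (hr.differentiableAt two_ne_zero) (hΦ.differentiableAt two_ne_zero)]
    rfl
  rw [leviSpan, leviSpan]
  congr 1
  ext y
  constructor
  · rintro ⟨v, hv, rfl⟩
    exact ⟨_, (hker v).1 hv, (leviForm_comp hr hΦ v v).symm⟩
  · rintro ⟨u, hu, rfl⟩
    obtain ⟨v, rfl⟩ := hsurj u
    exact ⟨v, (hker v).2 hu, leviForm_comp hr hΦ v v⟩

end LeviForm

section Complexification

variable {V W : Type*} [AddCommGroup V] [Module ℝ V] [AddCommGroup W] [Module ℝ W]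

/-- The element `a + i b` of the complexification `ℂ ⊗ V` of a real vector space `V`. -/
def complexify (a b : V) : ℂ ⊗[ℝ] V := (1 : ℂ) ⊗ₜ[ℝ] a + Complex.I ⊗ₜ[ℝ] b

theorem complexify_add (a b a' b' : V) :
    complexify a b + complexify a' b' = complexify (a + a') (b + b') := by
  simp only [complexify, TensorProduct.tmul_add]
  abel

theorem tmul_eq_complexify (c : ℂ) (x : V) : c ⊗ₜ[ℝ] x = complexify (c.re • x) (c.im • x) := by
  have hc : c = c.re • (1 : ℂ) + c.im • Complex.I := by
    simp only [Complex.real_smul, mul_one, Complex.re_add_im]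
  rw [complexify, ← TensorProduct.smul_tmul, ← TensorProduct.smul_tmul, ← TensorProduct.add_tmul,
    ← hc]

theorem smul_complexify (c : ℂ) (a b : V) :
    c • complexify a b = complexify (c.re • a - c.im • b) (c.im • a + c.re • b) := by
  rw [complexify, smul_add, TensorProduct.smul_tmul', TensorProduct.smul_tmul',
    tmul_eq_complexify, tmul_eq_complexify, complexify_add]
  simp [sub_eq_add_neg]

theorem complexify_inj {a b a' b' : V} :
    complexify a b = complexify a' b' ↔ a = a' ∧ b = b' := by
  have key (φ : ℂ →ₗ[ℝ] ℝ) (a b : V) :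
      TensorProduct.lift (LinearMap.lsmul ℝ V ∘ₗ φ) (complexify a b) =
        φ 1 • a + φ Complex.I • b := by
    simp [complexify]
  refine ⟨fun h => ⟨?_, ?_⟩, by rintro ⟨rfl, rfl⟩; rfl⟩
  · simpa [key] using congrArg (TensorProduct.lift (LinearMap.lsmul ℝ V ∘ₗ Complex.reLm)) h
  · simpa [key] using congrArg (TensorProduct.lift (LinearMap.lsmul ℝ V ∘ₗ Complex.imLm)) h

theorem exists_complexify_eq (Z : ℂ ⊗[ℝ] V) : ∃ a b, complexify a b = Z := by
  induction Z with
  | zero => exact ⟨0, 0, by simp [complexify]⟩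
  | tmul c x => exact ⟨_, _, (tmul_eq_complexify c x).symm⟩
  | add x y hx hy =>
    obtain ⟨a, b, rfl⟩ := hx
    obtain ⟨a', b', rfl⟩ := hy
    exact ⟨_, _, (complexify_add a b a' b').symm⟩

theorem baseChange_complexify (f : V →ₗ[ℝ] W) (a b : V) :
    f.baseChange ℂ (complexify a b) = complexify (f a) (f b) := by
  simp [complexify]

theorem complexify_mem_baseChange {S : Submodule ℝ V} {a b : V} :
    complexify a b ∈ S.baseChange ℂ ↔ a ∈ S ∧ b ∈ S := by
  constructor
  · rintro ⟨y, hy⟩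
    obtain ⟨a', b', rfl⟩ := exists_complexify_eq y
    have hab : complexify (a' : V) (b' : V) = complexify a b := by
      rw [← hy]; simp [complexify]
    obtain ⟨rfl, rfl⟩ := complexify_inj.1 hab
    exact ⟨a'.2, b'.2⟩
  · rintro ⟨ha, hb⟩
    exact add_mem (Submodule.tmul_mem_baseChange_of_mem _ ha)
      (Submodule.tmul_mem_baseChange_of_mem _ hb)

end Complexification

section TangentSpace

variable {N : ℕ}

theorem J_apply (v : CSpace N) : J N v = Complex.I • v := rfl

theorem CField.eval_eq_complexify (X : CField N) (q : CSpace N) :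
    X.eval q = complexify (X.re q) (X.im q) := rfl

theorem complexify_mem_ker_J_sub_I {a b : CSpace N} :
    complexify a b ∈ LinearMap.ker ((J N).baseChange ℂ - Complex.I • LinearMap.id) ↔
      b = -(Complex.I • a) := by
  rw [LinearMap.mem_ker, LinearMap.sub_apply, sub_eq_zero, LinearMap.smul_apply,
    LinearMap.id_apply, baseChange_complexify, smul_complexify, complexify_inj]
  simp only [J_apply, Complex.I_re, Complex.I_im, zero_smul, one_smul, zero_sub, add_zero]
  refine ⟨fun h => by rw [h.1, neg_neg], ?_⟩
  rintro rfl
  simp [smul_smul]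

theorem complexify_mem_holTangent {M : Set (CSpace N)} {q a b : CSpace N} :
    complexify a b ∈ holTangent M q ↔
      a ∈ tangentSpace M q ∧ Complex.I • a ∈ tangentSpace M q ∧ b = -(Complex.I • a) := by
  rw [holTangent, Submodule.mem_inf, complexify_mem_ker_J_sub_I, complexify_mem_baseChange,
    and_assoc]
  refine and_congr_right fun _ => and_congr_left ?_
  rintro rfl
  exact neg_mem_iff

variable {F : Type*} [NormedAddCommGroup F] [NormedSpace ℝ F] {M : Set (CSpace N)} {q : CSpace N}
  {f : CSpace N → F}

theorem fderiv_eq_zero_of_mem_tangentSpace (hf : DifferentiableAt ℝ f q)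
    (hf0 : ∀ᶠ x in 𝓝[M] q, f x = 0) {v : CSpace N} (hv : v ∈ tangentSpace M q) :
    fderiv ℝ f q v = 0 := by
  suffices tangentSpace M q ≤ LinearMap.ker (fderiv ℝ f q).toLinearMap from this hv
  rw [tangentSpace, Submodule.span_le]
  rintro v ⟨γ, rfl, hγM, hγ⟩
  have hfγ : HasDerivAt (f ∘ γ) (fderiv ℝ f (γ 0) v) 0 := hf.hasFDerivAt.comp_hasDerivAt 0 hγ
  have hfγ0 : f ∘ γ =ᶠ[𝓝 0] fun _ => 0 :=
    (tendsto_nhdsWithin_iff.2 ⟨hγ.continuousAt, hγM⟩).eventually hf0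
  exact hfγ.unique ((hasDerivAt_const (0 : ℝ) (0 : F)).congr_of_eventuallyEq hfγ0)

theorem mem_tangentSpace_of_fderiv_eq_zero [FiniteDimensional ℝ F]
    (hf : ContDiffAt ℝ 1 f q) (hs : Function.Surjective (fderiv ℝ f q)) (hfq : f q = 0)
    (hM : ∀ᶠ x in 𝓝 q, f x = 0 → x ∈ M) {v : CSpace N} (hv : fderiv ℝ f q v = 0) :
    v ∈ tangentSpace M q := by
  have : CompleteSpace F := FiniteDimensional.complete ℝ F
  have hsf : HasStrictFDerivAt f (fderiv ℝ f q) q := hf.hasStrictFDerivAt one_ne_zero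
  have hr : (fderiv ℝ f q).range = ⊤ := LinearMap.range_eq_top.2 hs
  let g := hsf.implicitFunction f (fderiv ℝ f q) hr (f q)
  let w : (fderiv ℝ f q).ker := ⟨v, hv⟩
  have hg0 : g 0 = q := hsf.implicitFunction_apply_image hr
  have hline : HasDerivAt (fun t : ℝ => t • w) w 0 := by
    simpa using (hasDerivAt_id (0 : ℝ)).smul_const w
  have hcurve : HasDerivAt (fun t : ℝ => g (t • w)) v 0 :=
    (hsf.to_implicitFunction hr).hasFDerivAt.comp_hasDerivAt_of_eq 0 hline (zero_smul ℝ w).symm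
  refine Submodule.subset_span ⟨fun t => g (t • w), by simpa using hg0, ?_, hcurve⟩
  have hgq : Tendsto (fun t : ℝ => g (t • w)) (𝓝 0) (𝓝 q) := by
    simpa [hg0] using hcurve.continuousAt.tendsto
  have hlevel : Tendsto (fun t : ℝ => (f q, t • w)) (𝓝 0) (𝓝 (f q, 0)) :=
    tendsto_const_nhds.prodMk_nhds (by simpa using hline.continuousAt.tendsto)
  filter_upwards [hgq.eventually hM, hlevel.eventually (hsf.map_implicitFunction_eq hr)]
    with t hgM hfg using hgM (hfg.trans hfq)

end TangentSpace

theorem lieBracket_neg_left {V : Type*} [NormedAddCommGroup V] [NormedSpace ℝ V] (X Y : V → V)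
    (q : V) :
    VectorField.lieBracket ℝ (fun x => -X x) Y q = -VectorField.lieBracket ℝ X Y q := by
  simp only [VectorField.lieBracket, fderiv_fun_neg, neg_apply, map_neg]
  abel

section GenericDefining

variable {N : ℕ} {F : Type*} [NormedAddCommGroup F] [NormedSpace ℝ F]

/-- Near `p ∈ M`, the set `M` is the zero set of the `C²` map `ρ` with values in a real vector
space, and `M` is a generic submanifold near `p`: surjectivity of `(dρ, dρ ∘ J)` at `p` says that
the components of `∂ρ` are linearly independent over `ℂ`. -/
structure IsGenericDefining (M : Set (CSpace N)) (p : CSpace N) (ρ : CSpace N → F) : Prop where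
  mem : p ∈ M
  contDiffAt : ContDiffAt ℝ 2 ρ p
  mem_iff : ∀ᶠ x in 𝓝 p, x ∈ M ↔ ρ x = 0
  surjective_derivPair : Function.Surjective (derivPair ρ p)

/-- `V` is a `C¹` real vector field near `p` whose values along the level set `M` of `ρ` lie in the
complex tangent space, i.e. the real part of a section of `T^{(1,0)} M`. -/
def IsComplexTangentField (M : Set (CSpace N)) (p : CSpace N) (ρ : CSpace N → F)
    (V : CSpace N → CSpace N) : Prop :=
  ContDiffAt ℝ 1 V p ∧ ∀ᶠ q in 𝓝[M] p, V q ∈ complexKer ρ q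

variable {M : Set (CSpace N)} {p : CSpace N} {ρ : CSpace N → F}

namespace IsComplexTangentField

variable {V : CSpace N → CSpace N}

theorem neg (hV : IsComplexTangentField M p ρ V) :
    IsComplexTangentField M p ρ (fun q => -V q) :=
  ⟨hV.1.neg, hV.2.mono fun _ hq => neg_mem hq⟩

theorem I_smul (hV : IsComplexTangentField M p ρ V) :
    IsComplexTangentField M p ρ (fun q => Complex.I • V q) :=
  ⟨hV.1.const_smul Complex.I, hV.2.mono fun _ hq => I_smul_mem_complexKer hq⟩

theorem apply_mem_complexKer (hV : IsComplexTangentField M p ρ V) (hp : p ∈ M) :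
    V p ∈ complexKer ρ p :=
  hV.2.self_of_nhdsWithin hp

end IsComplexTangentField

namespace IsGenericDefining

theorem contDiffAt_derivPair (h : IsGenericDefining M p ρ) : ContDiffAt ℝ 1 (derivPair ρ) p := by
  have hd : ContDiffAt ℝ 1 (fderiv ℝ ρ) p := h.contDiffAt.fderiv_right (by norm_num)
  exact (ContinuousLinearMap.prodₗᵢ (𝕜 := ℝ) (E := CSpace N) (F := F) (G := F)
    ℝ).toContinuousLinearEquiv.contDiff.contDiffAt.comp p
      (hd.prodMk (hd.clm_comp contDiffAt_const))

theorem range_fderiv_eq_top (h : IsGenericDefining M p ρ) :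
    LinearMap.range (fderiv ℝ ρ p).toLinearMap = ⊤ :=
  LinearMap.range_eq_top.2 fun y =>
    (h.surjective_derivPair (y, 0)).imp fun _ hv => congrArg Prod.fst hv

variable [FiniteDimensional ℝ F]

theorem exists_rightInverse (h : IsGenericDefining M p ρ) :
    ∃ R : F × F →L[ℝ] CSpace N, derivPair ρ p ∘L R = 1 :=
  (derivPair ρ p).exists_rightInverse_of_surjective
    (LinearMap.range_eq_top.2 h.surjective_derivPair)

theorem eventually_isUnit_derivPair_comp (h : IsGenericDefining M p ρ)
    {R : F × F →L[ℝ] CSpace N} (hR : derivPair ρ p ∘L R = 1) :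
    ∀ᶠ q in 𝓝 p, IsUnit (derivPair ρ q ∘L R) := by
  have : CompleteSpace F := FiniteDimensional.complete ℝ F
  have hcont : ContinuousAt (fun q => derivPair ρ q ∘L R) p :=
    h.contDiffAt_derivPair.continuousAt.clm_comp continuousAt_const
  exact hcont.eventually (Units.isOpen.mem_nhds (by simp [hR]))

theorem eventually_tangentSpace_eq_ker (h : IsGenericDefining M p ρ) :
    ∀ᶠ q in 𝓝 p, q ∈ M → tangentSpace M q = LinearMap.ker (fderiv ℝ ρ q).toLinearMap := by
  obtain ⟨R, hR⟩ := h.exists_rightInverse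
  filter_upwards [h.eventually_isUnit_derivPair_comp hR, h.mem_iff.eventually_nhds,
    h.contDiffAt.eventually (by simp)] with q hunit hM hC hq
  obtain ⟨u, hu⟩ := hunit
  have hsurj : Function.Surjective (fderiv ℝ ρ q) := fun y => by
    have hy : (derivPair ρ q ∘L R) ((↑u⁻¹ : F × F →L[ℝ] F × F) (y, 0)) = (y, 0) := by
      rw [← hu, ← mul_apply_eq_comp, Units.mul_inv, one_apply_eq_self]
    exact ⟨_, congrArg Prod.fst hy⟩
  refine le_antisymm (fun v hv => ?_) fun v hv => ?_
  · refine fderiv_eq_zero_of_mem_tangentSpace (hC.differentiableAt two_ne_zero) ?_ hv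
    filter_upwards [nhdsWithin_le_nhds hM, self_mem_nhdsWithin] with x hx hxM using hx.1 hxM
  · exact mem_tangentSpace_of_fderiv_eq_zero (hC.of_le (by norm_num)) hsurj
      (hM.self_of_nhds.1 hq) (hM.mono fun _ hx => hx.2) hv

theorem tangentSpace_eq_ker (h : IsGenericDefining M p ρ) :
    tangentSpace M p = LinearMap.ker (fderiv ℝ ρ p).toLinearMap :=
  h.eventually_tangentSpace_eq_ker.self_of_nhds h.mem

theorem complexKer_le_tangentSpace (h : IsGenericDefining M p ρ) :
    complexKer ρ p ≤ tangentSpace M p := fun v hv => by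
  rw [h.tangentSpace_eq_ker]
  exact (mem_complexKer.1 hv).1

theorem eventually_complexify_mem_holTangent_iff (h : IsGenericDefining M p ρ) :
    ∀ᶠ q in 𝓝[M] p, ∀ a b, complexify a b ∈ holTangent M q ↔
      a ∈ complexKer ρ q ∧ b = -(Complex.I • a) := by
  filter_upwards [nhdsWithin_le_nhds h.eventually_tangentSpace_eq_ker, self_mem_nhdsWithin]
    with q hq hqM a b
  rw [complexify_mem_holTangent, hq hqM, ← and_assoc, mem_complexKer]
  rfl

theorem complexify_mem_holTangent_iff (h : IsGenericDefining M p ρ) {a b : CSpace N} :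
    complexify a b ∈ holTangent M p ↔ a ∈ complexKer ρ p ∧ b = -(Complex.I • a) :=
  h.eventually_complexify_mem_holTangent_iff.self_of_nhdsWithin h.mem a b

theorem isHolField_iff (h : IsGenericDefining M p ρ) {X : CField N} :
    IsHolField M p X ↔ IsComplexTangentField M p ρ X.re ∧ IsComplexTangentField M p ρ X.im ∧
      ∀ᶠ q in 𝓝[M] p, X.im q = -(Complex.I • X.re q) := by
  have hiff : ∀ᶠ q in 𝓝[M] p, X.eval q ∈ holTangent M q ↔
      X.re q ∈ complexKer ρ q ∧ X.im q = -(Complex.I • X.re q) :=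
    h.eventually_complexify_mem_holTangent_iff.mono fun q hq => hq _ _
  constructor
  · rintro ⟨hre, him, hX⟩
    have hX' := (hiff.and hX).mono fun q hq => hq.1.1 hq.2
    refine ⟨⟨hre, hX'.mono fun q hq => hq.1⟩, ⟨him, hX'.mono fun q hq => ?_⟩,
      hX'.mono fun q hq => hq.2⟩
    rw [hq.2]
    exact neg_mem (I_smul_mem_complexKer hq.1)
  · rintro ⟨hre, him, hJ⟩
    exact ⟨hre.1, him.1, (hiff.and (hre.2.and hJ)).mono fun q hq => hq.1.2 hq.2⟩

/- With `R` a right inverse of `K p`, where `K q = (dρ, dρ ∘ J)` at `q`, the operator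
`1 - R (K q R)⁻¹ K q` is a projection onto `ker (K q)` depending on `q` in a `C¹` way. -/
theorem exists_isComplexTangentField (h : IsGenericDefining M p ρ) {v : CSpace N}
    (hv : v ∈ complexKer ρ p) : ∃ V, IsComplexTangentField M p ρ V ∧ V p = v := by
  have : CompleteSpace F := FiniteDimensional.complete ℝ F
  obtain ⟨R, hR⟩ := h.exists_rightInverse
  refine ⟨fun q => v - R (Ring.inverse (derivPair ρ q ∘L R) (derivPair ρ q v)), ⟨?_, ?_⟩, ?_⟩
  · have hK := h.contDiffAt_derivPair
    have hKR : ContDiffAt ℝ 1 (fun q => derivPair ρ q ∘L R) p := hK.clm_comp contDiffAt_const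
    have hinv : ContDiffAt ℝ 1 (Ring.inverse : (F × F →L[ℝ] F × F) → _) (derivPair ρ p ∘L R) := by
      rw [hR]
      exact contDiffAt_ringInverse ℝ (1 : (F × F →L[ℝ] F × F)ˣ)
    exact contDiffAt_const.sub (R.contDiff.contDiffAt.comp p
      ((hinv.comp p hKR).clm_apply (hK.clm_apply contDiffAt_const)))
  · refine nhdsWithin_le_nhds ?_
    filter_upwards [h.eventually_isUnit_derivPair_comp hR] with q hq
    have hcancel := DFunLike.congr_fun (Ring.mul_inverse_cancel _ hq) (derivPair ρ q v)
    rw [complexKer, LinearMap.mem_ker, map_sub, sub_eq_zero]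
    exact hcancel.symm
  · have hv0 : derivPair ρ p v = 0 := hv
    simp [hv0]

theorem exists_isHolField (h : IsGenericDefining M p ρ) {v : CSpace N}
    (hv : v ∈ complexKer ρ p) : ∃ X : CField N, IsHolField M p X ∧
      X.re p = v ∧ X.im p = -(Complex.I • v) := by
  obtain ⟨V, hV, rfl⟩ := h.exists_isComplexTangentField hv
  exact ⟨⟨V, fun q => -(Complex.I • V q)⟩,
    h.isHolField_iff.2 ⟨hV, hV.I_smul.neg, Eventually.of_forall fun _ => rfl⟩, rfl, rfl⟩

theorem fderiv_fderiv_field (h : IsGenericDefining M p ρ) {V : CSpace N → CSpace N}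
    {u : CSpace N} (hV : IsComplexTangentField M p ρ V) (hu : u ∈ complexKer ρ p) :
    fderiv ℝ ρ p (fderiv ℝ V p u) = -fderiv ℝ (fderiv ℝ ρ) p u (V p) := by
  have hD := differentiableAt_fderiv_of_contDiffAt h.contDiffAt
  have hVd : DifferentiableAt ℝ V p := hV.1.differentiableAt one_ne_zero
  have hzero : fderiv ℝ (fun q => fderiv ℝ ρ q (V q)) p u = 0 :=
    fderiv_eq_zero_of_mem_tangentSpace (hD.clm_apply hVd)
      (hV.2.mono fun _ hq => (mem_complexKer.1 hq).1) (h.complexKer_le_tangentSpace hu)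
  rw [fderiv_clm_apply hD hVd] at hzero
  exact eq_neg_of_add_eq_zero_left hzero

theorem fderiv_I_smul_fderiv_field (h : IsGenericDefining M p ρ) {V : CSpace N → CSpace N}
    {u : CSpace N} (hV : IsComplexTangentField M p ρ V) (hu : u ∈ complexKer ρ p) :
    fderiv ℝ ρ p (Complex.I • fderiv ℝ V p u) =
      -fderiv ℝ (fderiv ℝ ρ) p u (Complex.I • V p) := by
  rw [← h.fderiv_fderiv_field hV.I_smul hu,
    fderiv_fun_const_smul (hV.1.differentiableAt one_ne_zero)]
  rfl

theorem fderiv_lieBracket (h : IsGenericDefining M p ρ) {V W : CSpace N → CSpace N}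
    (hV : IsComplexTangentField M p ρ V) (hW : IsComplexTangentField M p ρ W) :
    fderiv ℝ ρ p (VectorField.lieBracket ℝ V W p) = 0 := by
  rw [VectorField.lieBracket, map_sub, h.fderiv_fderiv_field hW (hV.apply_mem_complexKer h.mem),
    h.fderiv_fderiv_field hV (hW.apply_mem_complexKer h.mem), fderiv_fderiv_comm h.contDiffAt,
    sub_self]

theorem fderiv_I_smul_lieBracket (h : IsGenericDefining M p ρ) {V W : CSpace N → CSpace N}
    (hV : IsComplexTangentField M p ρ V) (hW : IsComplexTangentField M p ρ W) :
    fderiv ℝ ρ p (Complex.I • VectorField.lieBracket ℝ V W p) =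
      -leviForm ρ p (V p) (Complex.I • W p) := by
  rw [VectorField.lieBracket, smul_sub, map_sub,
    h.fderiv_I_smul_fderiv_field hW (hV.apply_mem_complexKer h.mem),
    h.fderiv_I_smul_fderiv_field hV (hW.apply_mem_complexKer h.mem), leviForm_I_smul_right,
    fderiv_fderiv_comm h.contDiffAt (W p)]
  abel

theorem fderiv_I_smul_lieBracket_re_im (h : IsGenericDefining M p ρ) {X : CField N}
    (hX : IsHolField M p X) :
    fderiv ℝ ρ p (Complex.I • VectorField.lieBracket ℝ X.re X.im p) =
      -leviForm ρ p (X.re p) (X.re p) := by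
  obtain ⟨hre, him, hJ⟩ := h.isHolField_iff.1 hX
  rw [h.fderiv_I_smul_lieBracket hre him, hJ.self_of_nhdsWithin h.mem, smul_neg, I_smul_I_smul,
    neg_neg]

end IsGenericDefining

end GenericDefining

section LeviMap

variable {N : ℕ} {F : Type*} [NormedAddCommGroup F] [NormedSpace ℝ F] {M : Set (CSpace N)}
  {p : CSpace N} {ρ : CSpace N → F}

theorem eval_conj_bracket (X : CField N) (p : CSpace N) :
    (X.conj.bracket X).eval p =
      complexify 0 ((2 : ℝ) • VectorField.lieBracket ℝ X.re X.im p) := by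
  have hre : (X.conj.bracket X).re p = 0 := by
    simp [CField.bracket, CField.conj, lieBracket_neg_left]
  have him : (X.conj.bracket X).im p = (2 : ℝ) • VectorField.lieBracket ℝ X.re X.im p := by
    simp only [CField.bracket, CField.conj, lieBracket_neg_left]
    rw [VectorField.lieBracket_swap (V := X.im), neg_neg, two_smul]
  rw [CField.eval_eq_complexify, hre, him]

theorem isLeviValue_iff {Z : CTangent N} {η : normalSpace M p} :
    IsLeviValue M p Z η ↔ ∃ X : CField N, IsHolField M p X ∧ X.eval p = Z ∧
      η = normalProj M p (Complex.I • VectorField.lieBracket ℝ X.re X.im p) := by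
  refine exists_congr fun X => and_congr_right fun _ => and_congr_right fun _ => ?_
  have hre : (1 / (2 * Complex.I)).re = 0 := by simp
  have him : (1 / (2 * Complex.I)).im = -(1 / 2) := by simp
  have hη : (1 : ℂ) ⊗ₜ[ℝ] η = complexify η 0 := by simp [complexify]
  rw [hη, eval_conj_bracket, baseChange_complexify, baseChange_complexify, smul_complexify, hre,
    him, complexify_inj]
  simp [J_apply, smul_smul]

namespace IsGenericDefining

variable [FiniteDimensional ℝ F]

theorem isCompl_normalSpace_ker (h : IsGenericDefining M p ρ) :
    IsCompl (normalSpace M p) (LinearMap.ker (fderiv ℝ ρ p).toLinearMap) := by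
  rw [← h.tangentSpace_eq_ker]
  exact (tangentSpace M p).isCompl_orthogonal.symm

/-- The isomorphism between the normal space of `M` at `p` and the target of a defining map `ρ`
induced by the derivative of `ρ` at `p`. -/
def normalEquiv (h : IsGenericDefining M p ρ) : normalSpace M p ≃ₗ[ℝ] F :=
  (LinearMap.kerComplementEquivRange _ h.isCompl_normalSpace_ker).trans
    (LinearEquiv.ofTop _ h.range_fderiv_eq_top)

theorem normalEquiv_normalProj (h : IsGenericDefining M p ρ) (v : CSpace N) :
    h.normalEquiv (normalProj M p v) = fderiv ℝ ρ p v := by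
  have htangent : v - (normalSpace M p).starProjection v ∈ tangentSpace M p := by
    rw [← Submodule.orthogonal_orthogonal (tangentSpace M p)]
    exact Submodule.sub_starProjection_mem_orthogonal v
  rw [h.tangentSpace_eq_ker] at htangent
  exact (sub_eq_zero.1 ((map_sub _ _ _).symm.trans htangent)).symm

theorem normalEquiv_of_isLeviValue (h : IsGenericDefining M p ρ) {v w : CSpace N}
    {η : normalSpace M p} (hη : IsLeviValue M p (complexify v w) η) :
    h.normalEquiv η = -leviForm ρ p v v := by
  obtain ⟨X, hX, hXp, rfl⟩ := isLeviValue_iff.1 hη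
  rw [h.normalEquiv_normalProj, h.fderiv_I_smul_lieBracket_re_im hX, (complexify_inj.1 hXp).1]

theorem normalEquiv_leviMap (h : IsGenericDefining M p ρ) {v w : CSpace N}
    (hvw : complexify v w ∈ holTangent M p) :
    h.normalEquiv (leviMap M p ⟨complexify v w, hvw⟩) = -leviForm ρ p v v := by
  obtain ⟨hv, rfl⟩ := h.complexify_mem_holTangent_iff.1 hvw
  obtain ⟨X, hX, hre, him⟩ := h.exists_isHolField hv
  have hex : ∃ η, IsLeviValue M p (complexify v (-(Complex.I • v))) η :=
    ⟨_, isLeviValue_iff.2 ⟨X, hX, by rw [CField.eval_eq_complexify, hre, him], rfl⟩⟩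
  rw [leviMap, dif_pos hex]
  exact h.normalEquiv_of_isLeviValue hex.choose_spec

theorem normalEquiv_image_range_leviMap (h : IsGenericDefining M p ρ) :
    h.normalEquiv '' Set.range (leviMap M p) = (fun v => -leviForm ρ p v v) '' complexKer ρ p := by
  ext y
  constructor
  · rintro ⟨_, ⟨⟨Z, hZ⟩, rfl⟩, rfl⟩
    obtain ⟨v, w, rfl⟩ := exists_complexify_eq Z
    exact ⟨v, (h.complexify_mem_holTangent_iff.1 hZ).1, (h.normalEquiv_leviMap hZ).symm⟩
  · rintro ⟨v, hv, rfl⟩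
    exact ⟨_, ⟨_, rfl⟩, h.normalEquiv_leviMap (h.complexify_mem_holTangent_iff.2 ⟨hv, rfl⟩)⟩

theorem map_span_range_leviMap (h : IsGenericDefining M p ρ) :
    (Submodule.span ℝ (Set.range (leviMap M p))).map h.normalEquiv.toLinearMap = leviSpan ρ p := by
  rw [Submodule.map_span, LinearEquiv.coe_coe, h.normalEquiv_image_range_leviMap, leviSpan,
    ← Submodule.span_neg, ← Set.image_neg_eq_neg, Set.image_image]
  simp only [neg_neg]

theorem span_range_leviMap_eq_top_iff (h : IsGenericDefining M p ρ) :
    Submodule.span ℝ (Set.range (leviMap M p)) = ⊤ ↔ leviSpan ρ p = ⊤ := by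
  rw [← h.map_span_range_leviMap, Submodule.map_eq_top_iff]

end IsGenericDefining

end LeviMap

section RealPoints

variable {V : Type*} [AddCommGroup V] [Module ℝ V]

/-- The real vectors contained in a complex subspace of the complexification `ℂ ⊗ V`. -/
def realPoints (S : Submodule ℂ (ℂ ⊗[ℝ] V)) : Submodule ℝ V :=
  (S.restrictScalars ℝ).comap (TensorProduct.mk ℝ ℂ V 1)

variable {S : Submodule ℂ (ℂ ⊗[ℝ] V)}

theorem mem_realPoints_iff_complexify_left {a : V} : a ∈ realPoints S ↔ complexify a 0 ∈ S := by
  rw [complexify, TensorProduct.tmul_zero, add_zero]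
  rfl

theorem mem_realPoints_iff_complexify_right {b : V} :
    b ∈ realPoints S ↔ complexify 0 b ∈ S := by
  have hb : Complex.I • complexify b 0 = complexify 0 b := by
    simp [smul_complexify]
  rw [mem_realPoints_iff_complexify_left, ← hb, S.smul_mem_iff Complex.I_ne_zero]

theorem baseChange_le_iff_le_realPoints {T : Submodule ℝ V} :
    T.baseChange ℂ ≤ S ↔ T ≤ realPoints S := by
  rw [Submodule.baseChange_eq_span, Submodule.span_le]
  exact Set.image_subset_iff

end RealPoints

theorem exists_fin_family_span_eq {R V F : Type*} [Semiring R] [AddCommMonoid V] [Module R V]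
    [AddCommMonoid F] [Module R F] [IsNoetherian R V] [IsNoetherian R F] (K : Submodule R V)
    (f : V → F) : ∃ (m : ℕ) (v : Fin m → V), (∀ i, v i ∈ K) ∧
      Submodule.span R (Set.range v) = K ∧
      Submodule.span R (Set.range (f ∘ v)) = Submodule.span R (f '' K) := by
  classical
  obtain ⟨s, hs⟩ := IsNoetherian.noetherian K
  obtain ⟨_, hfK, ht⟩ := (Submodule.fg_span_iff_fg_span_finset_subset (f '' (K : Set V))).1
    (IsNoetherian.noetherian (Submodule.span R (f '' (K : Set V))))
  obtain ⟨t, htK, rfl⟩ := Finset.subset_set_image_iff.1 hfK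
  obtain ⟨m, v, -, hv⟩ := (s ∪ t).finite_toSet.fin_param
  have hvK : Set.range v ⊆ K := by
    rw [hv, Finset.coe_union]
    exact Set.union_subset (hs ▸ Submodule.subset_span) htK
  refine ⟨m, v, fun i => hvK ⟨i, rfl⟩, le_antisymm (Submodule.span_le.2 hvK) ?_,
    le_antisymm (Submodule.span_mono ?_) ?_⟩
  · rw [← hs, hv]
    exact Submodule.span_mono (Finset.coe_subset.2 Finset.subset_union_left)
  · rintro _ ⟨i, rfl⟩
    exact ⟨v i, hvK ⟨i, rfl⟩, rfl⟩
  · rw [ht, Set.range_comp, hv, Finset.coe_image]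
    exact Submodule.span_mono (Set.image_mono (Finset.coe_subset.2 Finset.subset_union_right))

section FiniteType

variable {N : ℕ} {F : Type*} [NormedAddCommGroup F] [NormedSpace ℝ F] {M : Set (CSpace N)}
  {p : CSpace N} {ρ : CSpace N → F}

/-- The complex span of the values at `p` of the vector fields in `S` and of their brackets. -/
def bracketSpan (S : Set (CField N)) (p : CSpace N) : Submodule ℂ (CTangent N) :=
  Submodule.span ℂ
    ({Z | ∃ X ∈ S, Z = X.eval p} ∪ {Z | ∃ X ∈ S, ∃ Y ∈ S, Z = (X.bracket Y).eval p})

theorem re_mem_realPoints_bracketSpan {S : Set (CField N)} {X : CField N} (hX : X ∈ S)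
    (hconj : X.conj ∈ S) : X.re p ∈ realPoints (bracketSpan S p) := by
  have hsum : X.eval p + X.conj.eval p = complexify ((2 : ℝ) • X.re p) 0 := by
    rw [CField.eval_eq_complexify, CField.eval_eq_complexify, complexify_add, two_smul]
    simp [CField.conj]
  rw [← Submodule.smul_mem_iff _ (two_ne_zero' ℝ), mem_realPoints_iff_complexify_left, ← hsum]
  exact add_mem (Submodule.subset_span (Or.inl ⟨X, hX, rfl⟩))
    (Submodule.subset_span (Or.inl ⟨X.conj, hconj, rfl⟩))

theorem lieBracket_mem_realPoints_bracketSpan {S : Set (CField N)} {X : CField N} (hX : X ∈ S)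
    (hconj : X.conj ∈ S) :
    VectorField.lieBracket ℝ X.re X.im p ∈ realPoints (bracketSpan S p) := by
  rw [← Submodule.smul_mem_iff _ (two_ne_zero' ℝ), mem_realPoints_iff_complexify_right,
    ← eval_conj_bracket]
  exact Submodule.subset_span (Or.inr ⟨_, hconj, _, hX, rfl⟩)

/-- The tangent vectors of `M` at `p` which `dρ ∘ J` maps into the span of the values of the Levi
form; all sections of `T^{(1,0)} M` and their brackets take values in its complexification. -/
def leviTangent (M : Set (CSpace N)) (p : CSpace N) (ρ : CSpace N → F) : Submodule ℝ (CSpace N) :=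
  tangentSpace M p ⊓ (leviSpan ρ p).comap ((fderiv ℝ ρ p).toLinearMap ∘ₗ J N)

namespace IsGenericDefining

variable [FiniteDimensional ℝ F]

theorem complexKer_le_leviTangent (h : IsGenericDefining M p ρ) :
    complexKer ρ p ≤ leviTangent M p ρ := by
  refine le_inf h.complexKer_le_tangentSpace fun v hv => ?_
  have hJv : fderiv ℝ ρ p (Complex.I • v) = 0 := (mem_complexKer.1 hv).2
  rw [Submodule.mem_comap, LinearMap.comp_apply, J_apply, ContinuousLinearMap.coe_coe, hJv]
  exact zero_mem _

theorem lieBracket_mem_tangentSpace (h : IsGenericDefining M p ρ) {V W : CSpace N → CSpace N}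
    (hV : IsComplexTangentField M p ρ V) (hW : IsComplexTangentField M p ρ W) :
    VectorField.lieBracket ℝ V W p ∈ tangentSpace M p := by
  rw [h.tangentSpace_eq_ker]
  exact h.fderiv_lieBracket hV hW

theorem lieBracket_mem_leviTangent (h : IsGenericDefining M p ρ) {V W : CSpace N → CSpace N}
    (hV : IsComplexTangentField M p ρ V) (hW : IsComplexTangentField M p ρ W) :
    VectorField.lieBracket ℝ V W p ∈ leviTangent M p ρ := by
  refine ⟨h.lieBracket_mem_tangentSpace hV hW, ?_⟩
  change fderiv ℝ ρ p (Complex.I • VectorField.lieBracket ℝ V W p) ∈ leviSpan ρ p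
  rw [h.fderiv_I_smul_lieBracket hV hW]
  exact neg_mem (leviForm_mem_leviSpan h.contDiffAt (hV.apply_mem_complexKer h.mem)
    (I_smul_mem_complexKer (hW.apply_mem_complexKer h.mem)))

theorem bracketSpan_le_baseChange_leviTangent (h : IsGenericDefining M p ρ) {S : Set (CField N)}
    (hS : ∀ X ∈ S, IsComplexTangentField M p ρ X.re ∧ IsComplexTangentField M p ρ X.im) :
    bracketSpan S p ≤ (leviTangent M p ρ).baseChange ℂ := by
  have heval {V : CSpace N → CSpace N} (hV : IsComplexTangentField M p ρ V) :
      V p ∈ leviTangent M p ρ := h.complexKer_le_leviTangent (hV.apply_mem_complexKer h.mem)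
  rw [bracketSpan, Submodule.span_le]
  rintro _ (⟨X, hX, rfl⟩ | ⟨X, hX, Y, hY, rfl⟩)
  · exact complexify_mem_baseChange.2 ⟨heval (hS X hX).1, heval (hS X hX).2⟩
  · exact complexify_mem_baseChange.2
      ⟨sub_mem (h.lieBracket_mem_leviTangent (hS X hX).1 (hS Y hY).1)
        (h.lieBracket_mem_leviTangent (hS X hX).2 (hS Y hY).2),
      add_mem (h.lieBracket_mem_leviTangent (hS X hX).1 (hS Y hY).2)
        (h.lieBracket_mem_leviTangent (hS X hX).2 (hS Y hY).1)⟩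

theorem isComplexTangentField_of_mem_range_union (h : IsGenericDefining M p ρ) {ι : Type*}
    {L : ι → CField N} (hL : ∀ i, IsHolField M p (L i)) :
    ∀ X ∈ Set.range L ∪ Set.range fun i => (L i).conj,
      IsComplexTangentField M p ρ X.re ∧ IsComplexTangentField M p ρ X.im := by
  rintro _ (⟨i, rfl⟩ | ⟨i, rfl⟩) <;> obtain ⟨hre, him, -⟩ := h.isHolField_iff.1 (hL i)
  · exact ⟨hre, him⟩
  · exact ⟨hre, him.neg⟩

theorem leviSpan_eq_top_of_tangentSpace_le (h : IsGenericDefining M p ρ)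
    (hT : tangentSpace M p ≤ leviTangent M p ρ) : leviSpan ρ p = ⊤ := by
  rw [eq_top_iff]
  rintro y -
  obtain ⟨t, ht⟩ := h.surjective_derivPair (0, y)
  have htT : t ∈ tangentSpace M p := by
    rw [h.tangentSpace_eq_ker]
    exact congrArg Prod.fst ht
  have hJt : fderiv ℝ ρ p (Complex.I • t) = y := congrArg Prod.snd ht
  exact hJt ▸ (hT htT).2

theorem leviSpan_eq_top_of_isFiniteTypeTwo (h : IsGenericDefining M p ρ)
    (hfin : IsFiniteTypeTwo M p) : leviSpan ρ p = ⊤ := by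
  obtain ⟨m, L, hL, S, rfl, hspan⟩ := hfin
  have hle :=
    h.bracketSpan_le_baseChange_leviTangent (h.isComplexTangentField_of_mem_range_union hL)
  rw [bracketSpan, hspan] at hle
  exact h.leviSpan_eq_top_of_tangentSpace_le fun t ht =>
    (complexify_mem_baseChange.1 (hle (complexify_mem_baseChange.2 ⟨ht, zero_mem _⟩))).1

theorem tangentSpace_le_of_complexKer_le (h : IsGenericDefining M p ρ)
    {P : Submodule ℝ (CSpace N)} (hK : complexKer ρ p ≤ P)
    (hP : (P ⊓ tangentSpace M p).map ((fderiv ℝ ρ p).toLinearMap ∘ₗ J N) = ⊤) :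
    tangentSpace M p ≤ P := fun t ht => by
  obtain ⟨s, ⟨hsP, hsT⟩, hst⟩ : fderiv ℝ ρ p (Complex.I • t) ∈
      (P ⊓ tangentSpace M p).map ((fderiv ℝ ρ p).toLinearMap ∘ₗ J N) := hP ▸ Submodule.mem_top
  have hJ : fderiv ℝ ρ p (Complex.I • (t - s)) = 0 := by
    rw [smul_sub, map_sub, sub_eq_zero]
    exact hst.symm
  have hts : t - s ∈ tangentSpace M p := sub_mem ht hsT
  rw [h.tangentSpace_eq_ker] at hts
  simpa using add_mem (hK (mem_complexKer.2 ⟨hts, hJ⟩)) hsP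

theorem isFiniteTypeTwo_of_leviSpan_eq_top (h : IsGenericDefining M p ρ)
    (hspan : leviSpan ρ p = ⊤) : IsFiniteTypeTwo M p := by
  obtain ⟨m, v, hvK, hvspan, hℓspan⟩ :=
    exists_fin_family_span_eq (complexKer ρ p) fun v => leviForm ρ p v v
  choose L hL hre _ using fun i => h.exists_isHolField (hvK i)
  have hfield := h.isComplexTangentField_of_mem_range_union hL
  have hLS (i : Fin m) : L i ∈ Set.range L ∪ Set.range fun i => (L i).conj := Or.inl ⟨i, rfl⟩
  have hconjS (i : Fin m) : (L i).conj ∈ Set.range L ∪ Set.range fun i => (L i).conj :=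
    Or.inr ⟨i, rfl⟩
  refine ⟨m, L, hL, _, rfl, le_antisymm ((h.bracketSpan_le_baseChange_leviTangent hfield).trans
    (Submodule.baseChange_mono ℂ inf_le_left)) ?_⟩
  refine baseChange_le_iff_le_realPoints.2 (h.tangentSpace_le_of_complexKer_le ?_ ?_)
  · rw [← hvspan, Submodule.span_le]
    exact Set.range_subset_iff.2 fun i =>
      hre i ▸ re_mem_realPoints_bracketSpan (hLS i) (hconjS i)
  · rw [eq_top_iff, ← hspan, leviSpan, ← hℓspan, Submodule.span_le, Set.range_subset_iff]
    intro i
    have hlieT := h.lieBracket_mem_tangentSpace (hfield _ (hLS i)).1 (hfield _ (hLS i)).2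
    have hlie := lieBracket_mem_realPoints_bracketSpan (p := p) (hLS i) (hconjS i)
    refine ⟨_, neg_mem (Submodule.mem_inf.2 ⟨hlie, hlieT⟩), ?_⟩
    have hval := h.fderiv_I_smul_lieBracket_re_im (hL i)
    rw [hre] at hval
    rw [map_neg, LinearMap.comp_apply, J_apply, ContinuousLinearMap.coe_coe, hval, neg_neg]
    rfl

theorem isFiniteTypeTwo_iff (h : IsGenericDefining M p ρ) :
    IsFiniteTypeTwo M p ↔ leviSpan ρ p = ⊤ :=
  ⟨h.leviSpan_eq_top_of_isFiniteTypeTwo, h.isFiniteTypeTwo_of_leviSpan_eq_top⟩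

end IsGenericDefining

end FiniteType

section SpanCriteria

theorem span_eq_top_iff_not_exists_isCoatom {R V : Type*} [Semiring R] [AddCommMonoid V]
    [Module R V] [Module.Finite R V] (s : Set V) :
    Submodule.span R s = ⊤ ↔ ¬ ∃ H : Submodule R V, IsCoatom H ∧ s ⊆ (H : Set V) := by
  constructor
  · rintro hs ⟨H, hH, hsH⟩
    exact hH.1 (top_le_iff.1 (hs ▸ Submodule.span_le.2 hsH))
  · intro hs
    refine (eq_top_or_exists_le_coatom (Submodule.span R s)).resolve_right ?_
    rintro ⟨H, hH, hle⟩
    exact hs ⟨H, hH, Submodule.span_le.1 hle⟩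

theorem eq_top_iff_nonempty_interior {𝕜 V : Type*} [NontriviallyNormedField 𝕜]
    [NormedAddCommGroup V] [NormedSpace 𝕜 V] (S : Submodule 𝕜 V) :
    S = ⊤ ↔ (interior (S : Set V)).Nonempty := by
  refine ⟨?_, S.eq_top_of_nonempty_interior'⟩
  rintro rfl
  simp

theorem span_eq_top_iff_nonempty_interior_convexHull {V : Type*} [NormedAddCommGroup V]
    [NormedSpace ℝ V] [FiniteDimensional ℝ V] {s : Set V} (h0 : (0 : V) ∈ s) :
    Submodule.span ℝ s = ⊤ ↔ (interior (convexHull ℝ s)).Nonempty := by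
  rw [interior_convexHull_nonempty_iff_affineSpan_eq_top,
    AffineSubspace.affineSpan_eq_top_iff_vectorSpan_eq_top_of_nonempty ℝ V V ⟨0, h0⟩,
    vectorSpan_eq_span_vsub_set_right ℝ h0]
  simp

end SpanCriteria

namespace IsGenericDefining

variable {N : ℕ} {F : Type*} [NormedAddCommGroup F] [NormedSpace ℝ F] [FiniteDimensional ℝ F]
  {M : Set (CSpace N)} {p : CSpace N} {ρ : CSpace N → F}

theorem zero_mem_range_leviMap (h : IsGenericDefining M p ρ) : 0 ∈ Set.range (leviMap M p) := by
  have h0 : h.normalEquiv 0 ∈ h.normalEquiv '' Set.range (leviMap M p) := by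
    rw [h.normalEquiv_image_range_leviMap]
    exact ⟨0, zero_mem _, by simp⟩
  exact h.normalEquiv.injective.mem_set_image.1 h0

theorem tfae (h : IsGenericDefining M p ρ) :
    List.TFAE [
      leviSpan ρ p = ⊤,
      ¬ ∃ H : Submodule ℝ (normalSpace M p), IsCoatom H ∧ Set.range (leviMap M p) ⊆ H,
      (interior (convexHull ℝ (Set.range (leviMap M p)))).Nonempty,
      (interior (Submodule.span ℝ (Set.range (leviMap M p)) : Set (normalSpace M p))).Nonempty,
      IsFiniteTypeTwo M p] := by
  rw [← span_eq_top_iff_not_exists_isCoatom,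
    ← span_eq_top_iff_nonempty_interior_convexHull h.zero_mem_range_leviMap,
    ← eq_top_iff_nonempty_interior, h.span_range_leviMap_eq_top_iff, h.isFiniteTypeTwo_iff]
  tfae_finish

end IsGenericDefining

section HermitianForms

theorem linearIndependent_complex_iff_real {ι V : Type*} [AddCommGroup V] [Module ℂ V]
    [StarAddMonoid V] [StarModule ℂ V] {x : ι → V} (hx : ∀ i, IsSelfAdjoint (x i)) :
    LinearIndependent ℂ x ↔ LinearIndependent ℝ x := by
  refine ⟨fun h => h.restrict_scalars' ℝ, fun h => ?_⟩
  rw [linearIndependent_iff'] at h ⊢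
  intro s g hg i hi
  have hre : ∑ j ∈ s, (g j).re • x j = 0 := by
    have := congrArg (fun v => (realPart v : V)) hg
    simpa [realPart_smul, (hx _).coe_realPart, (hx _).imaginaryPart] using this
  have him : ∑ j ∈ s, (g j).im • x j = 0 := by
    have := congrArg (fun v => (imaginaryPart v : V)) hg
    simpa [imaginaryPart_smul, (hx _).coe_realPart, (hx _).imaginaryPart] using this
  exact Complex.ext (h s _ hre i hi) (h s _ him i hi)

variable {κ : Type*} [Fintype κ]

/-- The quadratic form `z ↦ Re (ᵗz̄ B z)` as a linear function of the matrix `B`; the real part is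
redundant when `B` is Hermitian. -/
def hermForm : Matrix κ κ ℂ →ₗ[ℝ] (κ → ℂ) → ℝ where
  toFun B z := (star z ⬝ᵥ B *ᵥ z).re
  map_add' B C := by ext z; simp [Matrix.add_mulVec]
  map_smul' c B := by ext z; simp [Matrix.smul_mulVec]

theorem hermForm_apply (B : Matrix κ κ ℂ) (z : κ → ℂ) :
    hermForm B z = (star z ⬝ᵥ B *ᵥ z).re := rfl

theorem ofReal_hermForm {B : Matrix κ κ ℂ} (hB : B.IsHermitian) (z : κ → ℂ) :
    (hermForm B z : ℂ) = star z ⬝ᵥ B *ᵥ z :=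
  Complex.ext rfl (hB.im_star_dotProduct_mulVec_self z).symm

theorem eq_zero_of_hermForm_eq_zero {B : Matrix κ κ ℂ} (hB : B.IsHermitian)
    (h0 : hermForm B = 0) : B = 0 := by
  classical
  refine (LinearEquiv.map_eq_zero_iff (Matrix.toLpLin 2 2)).1 <|
    (inner_map_self_eq_zero _).1 fun z => ?_
  rw [EuclideanSpace.inner_eq_star_dotProduct, Matrix.ofLp_toLpLin, Matrix.toLin'_apply,
    Matrix.dotProduct_star, dotProduct_comm, ← ofReal_hermForm hB, h0]
  simp

theorem injOn_hermForm :
    Set.InjOn (hermForm : Matrix κ κ ℂ →ₗ[ℝ] (κ → ℂ) → ℝ) {B | B.IsHermitian} :=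
  fun B hB C hC h => sub_eq_zero.1 <|
    eq_zero_of_hermForm_eq_zero (hB.sub hC) (by rw [map_sub, h, sub_self])

variable {ι : Type*} {A : ι → Matrix κ κ ℂ}

/-- The values `(ᵗz̄ A_j z)_j` at `z` of the quadratic forms of the matrices `A_j`. -/
def hermValue (A : ι → Matrix κ κ ℂ) (z : κ → ℂ) : ι → ℝ := fun j => hermForm (A j) z

theorem linearIndependent_hermForm_iff (hA : ∀ j, (A j).IsHermitian) :
    LinearIndependent ℝ (hermForm ∘ A) ↔ LinearIndependent ℝ A := by
  refine hermForm.linearIndependent_iff_of_injOn (injOn_hermForm.mono ?_)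
  exact Submodule.span_le (p := selfAdjoint.submodule ℝ (Matrix κ κ ℂ)).2
    (Set.range_subset_iff.2 hA)

theorem span_range_hermValue_eq_top_iff [Finite ι] (hA : ∀ j, (A j).IsHermitian) :
    Submodule.span ℝ (Set.range (hermValue A)) = ⊤ ↔ LinearIndependent ℝ A := by
  rw [← linearIndependent_hermForm_iff hA]
  exact span_flip_eq_top_iff_linearIndependent

theorem contDiff_hermValue [Fintype ι] (A : ι → Matrix κ κ ℂ) {k : WithTop ℕ∞} :
    ContDiff ℝ k (hermValue A) := by
  refine contDiff_pi.2 fun j => Complex.reCLM.contDiff.comp ?_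
  unfold dotProduct Matrix.mulVec dotProduct
  refine ContDiff.sum fun i _ => ContDiff.mul ?_ (ContDiff.sum fun j _ => ?_)
  · exact Complex.conjCLE.contDiff.comp (contDiff_apply ℝ ℂ i)
  · exact contDiff_const.mul (contDiff_apply ℝ ℂ j)

theorem hermValue_complex_smul (A : ι → Matrix κ κ ℂ) (c : ℂ) (z : κ → ℂ) :
    hermValue A (c • z) = Complex.normSq c • hermValue A z := by
  ext j
  simp only [hermValue, hermForm_apply, star_smul, Matrix.mulVec_smul, smul_dotProduct,
    dotProduct_smul, Pi.smul_apply, smul_eq_mul]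
  rw [← mul_assoc, Complex.star_def, Complex.mul_conj, Complex.re_ofReal_mul]

theorem hermValue_zero (A : ι → Matrix κ κ ℂ) : hermValue A 0 = 0 := by
  simpa using hermValue_complex_smul A 0 0

end HermitianForms

section WeightedOrder

variable {E F G : Type*} [NormedAddCommGroup E] [NormedAddCommGroup F] [NormedAddCommGroup G]
  {h : E × F → G}

theorem apply_zero_of_isLittleO_weighted
    (ho : h =o[𝓝 0] fun x : E × F => ‖x.1‖ ^ 2 + ‖x.2‖) : h 0 = 0 := by
  simpa using (isLittleO_iff.1 ho one_pos).self_of_nhds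

theorem isLittleO_sq_of_isLittleO_weighted [NormedSpace ℝ E]
    (ho : h =o[𝓝 0] fun x : E × F => ‖x.1‖ ^ 2 + ‖x.2‖) (z : E) :
    (fun t : ℝ => h (t • z, 0)) =o[𝓝 0] fun t : ℝ => t ^ 2 := by
  have hline : Tendsto (fun t : ℝ => (t • z, (0 : F))) (𝓝 0) (𝓝 0) := by
    have : Continuous fun t : ℝ => (t • z, (0 : F)) := by fun_prop
    simpa [Prod.zero_eq_mk] using this.tendsto 0
  refine (ho.comp_tendsto hline).trans_isBigO
    (IsBigO.of_bound (‖z‖ ^ 2) (Eventually.of_forall fun t => ?_))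
  simp [norm_smul, mul_pow, mul_comm]

theorem hasFDerivAt_zero_of_isLittleO_weighted [NormedSpace ℝ E] [NormedSpace ℝ F]
    [NormedSpace ℝ G]
    (ho : h =o[𝓝 0] fun x : E × F => ‖x.1‖ ^ 2 + ‖x.2‖) :
    HasFDerivAt h (0 : E × F →L[ℝ] G) 0 := by
  rw [hasFDerivAt_iff_isLittleO_nhds_zero]
  simp only [zero_add, apply_zero_of_isLittleO_weighted ho, sub_zero, zero_apply]
  refine ho.trans_isBigO (IsBigO.of_bound 2 ?_)
  filter_upwards [Metric.ball_mem_nhds (0 : E × F) one_pos] with x hx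
  rw [mem_ball_zero_iff] at hx
  rw [Real.norm_of_nonneg (by positivity)]
  nlinarith [norm_nonneg x.1, norm_fst_le x, norm_snd_le x]

end WeightedOrder

section Reduced

/-- The projection `(z, w) ↦ (z, Re w)`. -/
def rePart (κ ι : Type*) : (κ → ℂ) × (ι → ℂ) →L[ℝ] (κ → ℂ) × (ι → ℝ) :=
  (ContinuousLinearMap.id ℝ (κ → ℂ)).prodMap (.piMap fun _ => Complex.reCLM)

/-- The projection `(z, w) ↦ Im w`. -/
def imPart (κ ι : Type*) : (κ → ℂ) × (ι → ℂ) →L[ℝ] (ι → ℝ) :=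
  (ContinuousLinearMap.piMap fun _ => Complex.imCLM) ∘L
    ContinuousLinearMap.snd ℝ (κ → ℂ) (ι → ℂ)

variable {κ ι : Type*} [Fintype κ]

/-- The map `(z, w) ↦ Im w - ᵗz̄ A z - h(z, Re w)`, whose zero set is given by reduced equations. -/
def reducedMap (A : ι → Matrix κ κ ℂ) (h : (κ → ℂ) × (ι → ℝ) → (ι → ℝ))
    (x : (κ → ℂ) × (ι → ℂ)) : ι → ℝ :=
  imPart κ ι x - hermValue A x.1 - h (rePart κ ι x)

variable [Fintype ι] {A : ι → Matrix κ κ ℂ} {h : (κ → ℂ) × (ι → ℝ) → (ι → ℝ)}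

theorem contDiffAt_reducedMap (hc : ContDiffAt ℝ 2 h 0) : ContDiffAt ℝ 2 (reducedMap A h) 0 := by
  refine ((imPart κ ι).contDiff.contDiffAt.sub
    ((contDiff_hermValue A).contDiffAt.comp _ contDiffAt_fst)).sub
      (ContDiffAt.comp _ ?_ (rePart κ ι).contDiff.contDiffAt)
  rwa [map_zero]

section

variable (ho : h =o[𝓝 0] fun x : (κ → ℂ) × (ι → ℝ) => ‖x.1‖ ^ 2 + ‖x.2‖)

include ho

theorem hasFDerivAt_reducedMap : HasFDerivAt (reducedMap A h) (imPart κ ι) 0 := by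
  have hherm : HasFDerivAt (hermValue A) (0 : (κ → ℂ) →L[ℝ] ι → ℝ) 0 := by
    have heven : (hermValue A).Even := fun z => by simpa using hermValue_complex_smul A (-1) z
    rw [← fderiv_zero_eq_zero_of_even (𝕜 := ℝ) heven]
    exact ((contDiff_hermValue A (k := 1)).differentiable one_ne_zero 0).hasFDerivAt
  have hfst : HasFDerivAt (fun x : (κ → ℂ) × (ι → ℂ) => hermValue A x.1) _ 0 :=
    hherm.comp (𝕜 := ℝ) (0 : (κ → ℂ) × (ι → ℂ)) (f := Prod.fst) hasFDerivAt_fst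
  have hh : HasFDerivAt h (0 : (κ → ℂ) × (ι → ℝ) →L[ℝ] ι → ℝ) (rePart κ ι 0) := by
    rw [map_zero]
    exact hasFDerivAt_zero_of_isLittleO_weighted ho
  refine (((imPart κ ι).hasFDerivAt.sub hfst).sub
    (hh.comp 0 (rePart κ ι).hasFDerivAt)).congr_fderiv ?_
  simp

theorem derivPair_reducedMap (x : (κ → ℂ) × (ι → ℂ)) :
    derivPair (reducedMap A h) 0 x = (fun k => (x.2 k).im, fun k => (x.2 k).re) := by
  rw [derivPair_apply, (hasFDerivAt_reducedMap ho).fderiv]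
  ext k <;> simp [imPart]

theorem surjective_derivPair_reducedMap : Function.Surjective (derivPair (reducedMap A h) 0) :=
  fun y => ⟨(0, fun k => ⟨y.2 k, y.1 k⟩), derivPair_reducedMap ho _⟩

theorem mem_complexKer_reducedMap {x : (κ → ℂ) × (ι → ℂ)} :
    x ∈ complexKer (reducedMap A h) 0 ↔ x.2 = 0 := by
  rw [complexKer, LinearMap.mem_ker, ContinuousLinearMap.coe_coe, derivPair_reducedMap ho,
    Prod.mk_eq_zero]
  simp only [funext_iff, Pi.zero_apply, Complex.ext_iff, Complex.zero_re, Complex.zero_im,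
    ← forall_and, and_comm]

theorem fderiv_fderiv_reducedMap (hc : ContDiffAt ℝ 2 h 0) (z : κ → ℂ) :
    fderiv ℝ (fderiv ℝ (reducedMap A h)) 0 (z, 0) (z, 0) = (-2 : ℝ) • hermValue A z := by
  have hexp (t : ℝ) : reducedMap A h (0 + t • (z, 0)) - reducedMap A h 0 -
      t • fderiv ℝ (reducedMap A h) 0 (z, 0) - t ^ 2 • -hermValue A z = -h (t • z, 0) := by
    have hquad : hermValue A (t • z) = t ^ 2 • hermValue A z := by
      simpa [sq] using hermValue_complex_smul A t z
    have hre : rePart κ ι (t • (z, 0)) = (t • z, 0) := by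
      ext <;> simp [rePart]
    rw [(hasFDerivAt_reducedMap ho).fderiv, zero_add, ← map_smul]
    simp only [reducedMap, map_zero, hre, Prod.smul_fst, Prod.fst_zero, hquad, hermValue_zero,
      apply_zero_of_isLittleO_weighted ho, smul_neg]
    abel
  rw [fderiv_fderiv_apply_self_of_isLittleO (a := -hermValue A z) (contDiffAt_reducedMap hc)
    ((isLittleO_sq_of_isLittleO_weighted ho z).neg_left.congr_left fun t => (hexp t).symm)]
  module

theorem leviForm_reducedMap (hc : ContDiffAt ℝ 2 h 0) (z : κ → ℂ) :
    leviForm (reducedMap A h) 0 (z, 0) (z, 0) = (-4 : ℝ) • hermValue A z := by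
  have hI : hermValue A (Complex.I • z) = hermValue A z := by
    simpa using hermValue_complex_smul A Complex.I z
  rw [leviForm_apply, Prod.smul_mk, smul_zero, fderiv_fderiv_reducedMap ho hc,
    fderiv_fderiv_reducedMap ho hc, hI]
  module

open scoped Pointwise in
theorem leviSpan_reducedMap (hc : ContDiffAt ℝ 2 h 0) :
    leviSpan (reducedMap A h) 0 = Submodule.span ℝ (Set.range (hermValue A)) := by
  have himage : (fun v => leviForm (reducedMap A h) 0 v v) '' complexKer (reducedMap A h) 0 =
      (-4 : ℝ) • Set.range (hermValue A) := by
    ext y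
    constructor
    · rintro ⟨⟨z, w⟩, hw, rfl⟩
      obtain rfl : w = 0 := (mem_complexKer_reducedMap ho).1 hw
      exact ⟨_, ⟨z, rfl⟩, (leviForm_reducedMap ho hc z).symm⟩
    · rintro ⟨_, ⟨z, rfl⟩, rfl⟩
      exact ⟨(z, 0), (mem_complexKer_reducedMap ho).2 rfl, leviForm_reducedMap ho hc z⟩
  rw [leviSpan, himage]
  exact Submodule.span_smul_eq_of_isUnit _ _ (isUnit_iff_ne_zero.2 (by norm_num))

end

end Reduced

section Invariance

theorem IsBiholomorphism.surjective_fderiv {E F : Type*} [NormedAddCommGroup E]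
    [NormedSpace ℂ E] [NormedAddCommGroup F] [NormedSpace ℂ F] {Φ : OpenPartialHomeomorph E F}
    (hΦ : IsBiholomorphism Φ) {x : E} (hx : x ∈ Φ.source) :
    Function.Surjective (fderiv ℂ Φ x) := by
  have hdΦ : HasFDerivAt Φ (fderiv ℂ Φ x) (Φ.symm (Φ x)) := by
    rw [Φ.left_inv hx]
    exact (hΦ.1.differentiableAt (Φ.open_source.mem_nhds hx)).hasFDerivAt
  have hdsymm : HasFDerivAt Φ.symm (fderiv ℂ Φ.symm (Φ x)) (Φ x) :=
    (hΦ.2.differentiableAt (Φ.open_target.mem_nhds (Φ.map_source hx))).hasFDerivAt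
  have hid : HasFDerivAt (Φ ∘ Φ.symm) (ContinuousLinearMap.id ℂ F) (Φ x) :=
    (hasFDerivAt_id (Φ x)).congr_of_eventuallyEq <|
      Φ.eventually_right_inverse (Φ.map_source hx)
  exact fun y => ⟨fderiv ℂ Φ.symm (Φ x) y,
    DFunLike.congr_fun ((hdΦ.comp (Φ x) hdsymm).unique hid) y⟩

namespace HasReducedEquation

variable {n d N : ℕ} {M : Set (CSpace N)} {p : CSpace N} {A : Fin d → Matrix (Fin n) (Fin n) ℂ}

theorem exists_isGenericDefining (hA : HasReducedEquation M p A) (hp : p ∈ M) :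
    ∃ ρ : CSpace N → (Fin d → ℝ), IsGenericDefining M p ρ ∧
      (leviSpan ρ p = ⊤ ↔ LinearIndependent ℝ A) := by
  obtain ⟨hH, Φ, h, hΦ, hpΦ, hΦp, hc, ho, hM⟩ := hA
  have hΦ₂ : ContDiffAt ℂ 2 Φ p :=
    (contDiffOn_of_differentiableOn_complex Φ.open_source 2 hΦ.1).contDiffAt
      (Φ.open_source.mem_nhds hpΦ)
  have hr : ContDiffAt ℝ 2 (reducedMap A h) (Φ p) := hΦp ▸ contDiffAt_reducedMap hc
  have hsurj := hΦ.surjective_fderiv hpΦ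
  refine ⟨reducedMap A h ∘ Φ, ⟨hp, hr.comp p (hΦ₂.restrict_scalars ℝ), ?_, fun y => ?_⟩, ?_⟩
  · filter_upwards [hM] with q hq
    simp only [hq, ← ofReal_hermForm (hH _), ← Complex.ofReal_add, Complex.ofReal_inj]
    rw [Function.comp_apply, reducedMap, sub_sub, sub_eq_zero, funext_iff]
    rfl
  · obtain ⟨x, rfl⟩ := surjective_derivPair_reducedMap (A := A) ho y
    obtain ⟨v, rfl⟩ := hsurj x
    exact ⟨v, by rw [derivPair_comp (hr.differentiableAt two_ne_zero)
      (hΦ₂.differentiableAt two_ne_zero), hΦp]⟩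
  · rw [leviSpan_comp hr hΦ₂ hsurj, hΦp, leviSpan_reducedMap ho hc,
      span_range_hermValue_eq_top_iff hH]

theorem linearIndependent_iff_isFiniteTypeTwo (hA : HasReducedEquation M p A) (hp : p ∈ M) :
    LinearIndependent ℝ A ↔ IsFiniteTypeTwo M p := by
  obtain ⟨ρ, hρ, hspan⟩ := hA.exists_isGenericDefining hp
  rw [← hspan, hρ.isFiniteTypeTwo_iff]

theorem comap {M' : Set (CSpace N)} {Ψ : OpenPartialHomeomorph (CSpace N) (CSpace N)}
    (hA : HasReducedEquation M' (Ψ p) A) (hΨ : IsBiholomorphism Ψ) (hp : p ∈ Ψ.source)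
    (hM : ∀ᶠ q in 𝓝 p, (q ∈ M ↔ Ψ q ∈ M')) : HasReducedEquation M p A := by
  obtain ⟨hH, Φ, h, hΦ, hpΦ, hΦp, hc, ho, hM'⟩ := hA
  refine ⟨hH, Ψ.trans Φ, h, ⟨?_, ?_⟩, ?_, hΦp, hc, ho, ?_⟩
  · rw [OpenPartialHomeomorph.trans_source]
    exact hΦ.1.comp (hΨ.1.mono Set.inter_subset_left) fun x hx => hx.2
  · rw [OpenPartialHomeomorph.trans_target]
    exact hΨ.2.comp (hΦ.2.mono Set.inter_subset_left) fun x hx => hx.2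
  · rw [OpenPartialHomeomorph.trans_source]
    exact ⟨hp, hpΦ⟩
  · filter_upwards [hM, (Ψ.continuousAt hp).eventually hM'] with q hq hq'
    exact hq.trans hq'

end HasReducedEquation

end Invariance

end LeviCR

end

theorem mainTheorem3 (n d : ℕ) (hn : 1 ≤ n) (hd : 1 ≤ d)
    (M : Set (LeviCR.CSpace (n + d)))
    (hM : LeviCR.IsC2Submanifold d M) (hgen : LeviCR.IsGeneric M)
    (p : LeviCR.CSpace (n + d)) (hp : p ∈ M)
    (A : Fin d → Matrix (Fin n) (Fin n) ℂ) (hA : LeviCR.HasReducedEquation M p A) :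
    List.TFAE [
      LinearIndependent ℝ A,
      LinearIndependent ℂ A,
      ¬ ∃ H : Submodule ℝ (LeviCR.normalSpace M p),
        IsCoatom H ∧ Set.range (LeviCR.leviMap M p) ⊆ (H : Set (LeviCR.normalSpace M p)),
      (interior (convexHull ℝ (Set.range (LeviCR.leviMap M p)))).Nonempty,
      (interior (Submodule.span ℝ (Set.range (LeviCR.leviMap M p)) :
        Set (LeviCR.normalSpace M p))).Nonempty,
      LeviCR.IsFiniteTypeTwo M p] ∧
    ∀ (M' : Set (LeviCR.CSpace (n + d))),
      LeviCR.IsC2Submanifold d M' → LeviCR.IsGeneric M' →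
      ∀ (F : OpenPartialHomeomorph (LeviCR.CSpace (n + d)) (LeviCR.CSpace (n + d))),
        LeviCR.IsBiholomorphism F → p ∈ F.source → (∀ᶠ q in 𝓝 p, (q ∈ M ↔ F q ∈ M')) →
        ∀ A' : Fin d → Matrix (Fin n) (Fin n) ℂ, LeviCR.HasReducedEquation M' (F p) A' →
          (LinearIndependent ℝ A ↔ LinearIndependent ℝ A') := by
  obtain ⟨ρ, hρ, hspan⟩ := hA.exists_isGenericDefining hp
  refine ⟨?_, fun M' _ _ F hF hpF hMM' A' hA' => ?_⟩
  · rw [LeviCR.linearIndependent_complex_iff_real hA.1, ← hspan]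
    exact List.tfae_cons_cons.2 ⟨Iff.rfl, hρ.tfae⟩
  · exact (hA.linearIndependent_iff_isFiniteTypeTwo hp).trans
      ((hA'.comap hF hpF hMM').linearIndependent_iff_isFiniteTypeTwo hp).symm
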